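/- Let $\mathbb F=\mathbb Q(q,t)$ with $q,t$ independent indeterminates, and let $\Lambda_{\mathbb F}$ be the ring of symmetric functions over $\mathbb F$ in variables $x=(x_1,x_2,\dots)$, with power sums $p_\lambda$ and monomial symmetric functions $m_\lambda$. Define $g_n$ by $\prod_i \frac{(t x_i y;q)_\infty}{(x_i y;q)_\infty}=\sum_{n\ge0}g_n(x;q,t)y^n$ and put $g_\lambda=g_{\lambda_1}g_{\lambda_2}\cdots$. Let $\langle\cdot,\cdot\rangle_{q,t}$ be Macdonald's scalar product, i.e. the bilinear form with $$\langle p_\lambda,p_\mu\rangle_{q,t}=\delta_{\lambda\mu}\prod_{i\ge1}i^{m_i}m_i!\prod_{j\ge 1}\frac{1-q^{\lambda_j}}{1-t^{\lambda_j}},$$ where $m_i$ is the number of parts of $\lambda$ equal to $i$. Let $P_\lambda=P_\lambda(x;q,t)$ be the Macdonald symmetric functions, obtained from the $m_\lambda$ by Gram--Schmidt orthogonalization with respect to $\langle\cdot,\cdot\rangle_{q,t}$ along the lexicographic order of the partitions $\lambda\vdash n$ (smallest first, each $m_\lambda$ having coefficient $1$ in $P_\lambda$), let $Q_\lambda=\langle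 P_\lambda,P_\lambda\rangle_{q,t}^{-1}P_\lambda$, and let $P_\lambda=\sum_{\mu\vdash n}c_{\lambda\mu}\,g_\mu$ ($\lambda\vdash n$) be the expansion of $P_\lambda$ in the $g_\mu$. For rational functions $f$ in $m$ variables and $g$ in $n$ variables over $\mathbb F$ set $$(f*g)(z_1,\dots,z_{m+n})=\frac1{(m+n)!}\sum_{\sigma\in\mathfrak S_{m+n}}\sigma\cdot\Big[f(z_1,\dots,z_m)\,g(z_{m+1},\dots,z_{m+n})\prod_{\alpha\le m<\beta}\omega(z_\alpha,z_\beta)\Big],$$ $$\omega(x,y)=\frac{(x-q^{-1}y)(x-ty)(x-qt^{-1}y)}{(x-y)^3},$$ where $\sigma$ acts by permuting the variables. Let $\epsilon_n(z_1,\dots,z_n;t)=\prod_{1\le i<j\le n}\frac{(z_i-tz_j)(z_i-t^{-1}z_j)}{(z_i-z_j)^2}$, and for a partition $\lambda=(\lambda_1\ge\dots\ge\lambda_l>0)$ of $n$ let $\epsilon_\lambda(z;t)=\epsilon_{\lambda_1}*\cdots*\epsilon_{\lambda_l}$. Define, for $\lambda\vdash n$, $$F_\lambda(z;q,t)=\frac{(-1)^n}{(1-q)^n\,n!}\sum_{\mu\vdash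 n}c_{\lambda\mu}\,\epsilon_\mu(z;t)\,\frac{|\mu|!}{\prod_i\mu_i!},\qquad K_n(x,z;q,t)=\sum_{\lambda\vdash n}Q_\lambda(x)\otimes F_\lambda(z;q,t).$$ Then for every $n\ge 0$: (1) Every family $(\widetilde P_\lambda)_{\lambda\vdash n}$ in $\Lambda_{\mathbb F}$ such that $\widetilde P_\lambda\in m_\lambda+\sum_{\mu<\lambda}\mathbb F\,m_\mu$ for the dominance order and $\langle\widetilde P_\lambda,\widetilde P_\mu\rangle_{q,t}=0$ for $\lambda\ne\mu$ coincides with $(P_\lambda)_{\lambda\vdash n}$. (2) In $\Lambda_{\mathbb F}\otimes_{\mathbb F}\mathbb F(z_1,\dots,z_n)$, $$K_n(x,z;q,t)=\frac{(-1)^n}{(1-q)^n\,n!}\sum_{\lambda\vdash n}m_\lambda(x)\otimes\epsilon_\lambda(z;t)\,\frac{|\lambda|!}{\prod_{i=1}^{\ell(\lambda)}\lambda_i!}.$$ -/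

import Mathlib

open scoped TensorProduct

noncomputable section

namespace MacdonaldKernel

/-! ### The base field `ℚ(q,t)` -/

/-- The field `𝔽 = ℚ(q,t)` of rational functions in two independent indeterminates. -/
abbrev BaseField : Type := FractionRing (MvPolynomial (Fin 2) ℚ)

/-- The indeterminate `q`. -/
def q : BaseField := algebraMap (MvPolynomial (Fin 2) ℚ) BaseField (MvPolynomial.X 0)

/-- The indeterminate `t`. -/
def t : BaseField := algebraMap (MvPolynomial (Fin 2) ℚ) BaseField (MvPolynomial.X 1)

/-! ### The ring of symmetric functions -/

/-- The ring `Λ` of symmetric functions over `ℚ(q,t)`: formal power series of bounded degree in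
`x₀, x₁, x₂, …` that are invariant under all permutations of the variables. -/
def SymFun : Subalgebra BaseField (MvPowerSeries ℕ BaseField) where
  carrier := {f | (∀ σ : Equiv.Perm ℕ, MvPowerSeries.renameEquiv BaseField σ f = f) ∧
    ∃ N : ℕ, ∀ d : ℕ →₀ ℕ, MvPowerSeries.coeff d f ≠ 0 → d.degree ≤ N}
  mul_mem' := by
    rintro f g ⟨hf, M, hM⟩ ⟨hg, N, hN⟩
    refine ⟨fun σ => by rw [map_mul, hf, hg], M + N, fun d hd => ?_⟩
    rw [MvPowerSeries.coeff_mul] at hd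
    obtain ⟨⟨a, b⟩, hab, h⟩ := Finset.exists_ne_zero_of_sum_ne_zero hd
    have h1 := hM a (left_ne_zero_of_mul h)
    have h2 := hN b (right_ne_zero_of_mul h)
    have hab' : a + b = d := by simpa using hab
    rw [← hab', map_add]
    omega
  add_mem' := by
    rintro f g ⟨hf, M, hM⟩ ⟨hg, N, hN⟩
    refine ⟨fun σ => by rw [map_add, hf, hg], max M N, fun d hd => ?_⟩
    by_cases h : MvPowerSeries.coeff d f = 0
    · rw [map_add, h, zero_add] at hd
      exact (hN d hd).trans (le_max_right _ _)
    · exact (hM d h).trans (le_max_left _ _)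
  algebraMap_mem' := by
    intro r
    refine ⟨fun σ => AlgEquiv.commutes _ r, 0, fun d hd => ?_⟩
    classical
    rw [MvPowerSeries.algebraMap_apply, MvPowerSeries.coeff_C] at hd
    by_cases h : d = 0
    · simp [h]
    · simp [h] at hd

/-- The multiset of non-zero exponents of a monomial. -/
def exponents (d : ℕ →₀ ℕ) : Multiset ℕ := d.support.val.map d

lemma exponents_sum (d : ℕ →₀ ℕ) : (exponents d).sum = d.degree := rfl

lemma exponents_embDomain (e : ℕ ↪ ℕ) (d : ℕ →₀ ℕ) :
    exponents (d.embDomain e) = exponents d := by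
  simp only [exponents, Finsupp.support_embDomain, Finset.map_val, Multiset.map_map]
  exact Multiset.map_congr rfl fun i _ => by simp

/-- The symmetric function of degree at most `N` in which the coefficient of a monomial is the
given function `c` of its multiset of non-zero exponents. -/
def ofExponents (N : ℕ) (c : Multiset ℕ → BaseField) (hc : ∀ s, c s ≠ 0 → s.sum ≤ N) : SymFun :=
  ⟨fun d => c (exponents d), by
    refine ⟨fun σ => ?_, N, fun d hd => exponents_sum d ▸ hc _ hd⟩
    ext d
    obtain ⟨d, rfl⟩ : ∃ d', d = Finsupp.embDomain σ.toEmbedding d' :=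
      ⟨Finsupp.equivMapDomain σ.symm d, by ext i; simp [Finsupp.embDomain_eq_mapDomain,
        ← Finsupp.equivMapDomain_eq_mapDomain]⟩
    have h := MvPowerSeries.coeff_embDomain_rename (R := BaseField) σ.toEmbedding
      (fun d => c (exponents d)) d
    refine Eq.trans h ?_
    change c (exponents d) = c (exponents (d.embDomain σ.toEmbedding))
    rw [exponents_embDomain]⟩

/-- The power sum `p_k = ∑ᵢ xᵢᵏ` (used for `k ≥ 1`). -/
def powerSum (k : ℕ) : SymFun :=
  ofExponents k (fun s => if s = {k} then 1 else 0) (by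
    intro s hs
    by_cases h : s = {k}
    · simp [h]
    · simp [h] at hs)

/-- `p_λ = p_{λ₁} p_{λ₂} ⋯`. -/
def powerSumPart {n : ℕ} (lam : n.Partition) : SymFun := (lam.parts.map powerSum).prod

/-- The monomial symmetric function `m_λ`: the sum of all distinct monomials whose non-zero
exponents are, up to order, the parts of `λ`. -/
def monomialSym {n : ℕ} (lam : n.Partition) : SymFun :=
  ofExponents n (fun s => if s = lam.parts then 1 else 0) (by
    intro s hs
    by_cases h : s = lam.parts
    · simp [h, lam.parts_sum]
    · simp [h] at hs)

/-- The formal power series `(y;q)_∞ = ∏_{i ≥ 0} (1 - qⁱ y)` in `y` over `ℚ(q,t)`. The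
`k`-th coefficient of the (`q`-adically convergent) product is
`∏_{j < k} (-qʲ / (1 - q^{j+1}))`. As shown below, this series has constant term `1` and satisfies
`(y;q)_∞ = (1 - y) (qy;q)_∞`, and these two properties determine it. -/
def qPochInf : PowerSeries BaseField :=
  PowerSeries.mk fun k => ∏ j ∈ Finset.range k, (-q ^ j / (1 - q ^ (j + 1)))

lemma one_sub_q_pow_ne_zero (j : ℕ) : (1 : BaseField) - q ^ (j + 1) ≠ 0 := by
  rw [sub_ne_zero, q, ← map_pow, ← map_one (algebraMap (MvPolynomial (Fin 2) ℚ) BaseField)]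
  intro h
  have h' := IsFractionRing.injective (MvPolynomial (Fin 2) ℚ) BaseField h
  have h2 := congrArg (MvPolynomial.eval (fun _ => (0 : ℚ))) h'
  simp at h2

lemma constantCoeff_qPochInf : PowerSeries.constantCoeff qPochInf = 1 := by
  simp [qPochInf]

lemma qPochInf_eq :
    qPochInf = (1 - PowerSeries.X) * PowerSeries.rescale q qPochInf := by
  ext k
  cases k with
  | zero =>
    rw [sub_mul, one_mul, map_sub, PowerSeries.coeff_zero_X_mul, PowerSeries.coeff_rescale]
    simp
  | succ k =>
    rw [sub_mul, one_mul, map_sub, PowerSeries.coeff_succ_X_mul]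
    simp only [qPochInf, PowerSeries.coeff_rescale, PowerSeries.coeff_mk, Finset.prod_range_succ]
    have h := one_sub_q_pow_ne_zero k
    field_simp
    ring

/-- The one-variable series `(ty;q)_∞ / (y;q)_∞`. -/
def oneVarG : PowerSeries BaseField := PowerSeries.rescale t qPochInf * qPochInf⁻¹

/-- `g_k(x;q,t)`, the coefficient of `yᵏ` in `G(y) = ∏ᵢ (t xᵢ y;q)_∞ / (xᵢ y;q)_∞`. The coefficient
of the monomial `∏ᵢ xᵢ^{dᵢ}` in it is zero unless `∑ᵢ dᵢ = k`, and otherwise it is the product over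
the non-zero exponents `dᵢ` of the `dᵢ`-th coefficients of the one-variable factor
(whose constant coefficient is `1`). -/
def gSym (k : ℕ) : SymFun :=
  ofExponents k
    (fun s => if s.sum = k then (s.map fun j => PowerSeries.coeff j oneVarG).prod else 0) (by
    intro s hs
    by_cases h : s.sum = k
    · exact h.le
    · simp [h] at hs)

/-- `g_λ = g_{λ₁} g_{λ₂} ⋯`. -/
def gSymPart {n : ℕ} (lam : n.Partition) : SymFun := (lam.parts.map gSym).prod

/-! ### Macdonald's scalar product and the Macdonald symmetric functions -/

/-- `∏_{i ≥ 1} i^{mᵢ} mᵢ! ∏_j (1 - q^{λⱼ}) / (1 - t^{λⱼ})`, where `mᵢ` is the number of parts of `λ`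
that are equal to `i`. -/
def powerSumNorm {n : ℕ} (lam : n.Partition) : BaseField :=
  (∏ i ∈ lam.parts.toFinset,
      (i : BaseField) ^ lam.parts.count i * ((lam.parts.count i).factorial : BaseField)) *
    (lam.parts.map fun j => (1 - q ^ j) / (1 - t ^ j)).prod

/-- The defining property of Macdonald's scalar product: its values on the basis `(p_λ)` of `Λ`,
where `λ` runs over all partitions of all natural numbers. -/
def IsMacdonaldForm (B : LinearMap.BilinForm BaseField SymFun) : Prop :=
  ∀ (k l : ℕ) (lam : k.Partition) (mu : l.Partition),
    B (powerSumPart lam) (powerSumPart mu) =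
      if lam.parts = mu.parts then powerSumNorm lam else 0

/-- Macdonald's scalar product `⟨·,·⟩_{q,t}`, the bilinear form on `Λ` with
`⟨p_λ,p_μ⟩ = δ_{λμ} ∏ i^{mᵢ} mᵢ! ∏ (1 - q^{λⱼ}) / (1 - t^{λⱼ})`. -/
def macdonaldForm : LinearMap.BilinForm BaseField SymFun := Classical.epsilon IsMacdonaldForm

/-- The parts `λ₁ ≥ λ₂ ≥ ⋯` of a partition in decreasing order. -/
def sortedParts {n : ℕ} (lam : n.Partition) : List ℕ := lam.parts.sort (· ≥ ·)

/-- The dominance order: `μ ≤ λ` if `μ₁ + ⋯ + μᵢ ≤ λ₁ + ⋯ + λᵢ` for all `i`. -/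
def DominanceLE {n : ℕ} (mu lam : n.Partition) : Prop :=
  ∀ i : ℕ, ((sortedParts mu).take i).sum ≤ ((sortedParts lam).take i).sum

open scoped Classical in
/-- The characterization of the Macdonald symmetric functions `(P_λ)_{λ ⊢ n}`:
(a) `P_λ = m_λ + ∑_{μ < λ} a_{λμ} m_μ` with `a_{λμ} ∈ 𝔽`, for the dominance order, and
(b) `⟨P_λ,P_μ⟩ = 0` if `λ ≠ μ`. -/
def IsMacdonaldFamily (n : ℕ) (P : n.Partition → SymFun) : Prop :=
  (∀ lam, ∃ a : n.Partition → BaseField,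
    P lam = monomialSym lam +
      ∑ mu ∈ Finset.univ.filter (fun mu => DominanceLE mu lam ∧ mu ≠ lam),
        a mu • monomialSym mu) ∧
  ∀ lam mu, lam ≠ mu → macdonaldForm (P lam) (P mu) = 0

/-- The strict lexicographic order on partitions of `n`, a total order that refines the
dominance order. -/
def LexLT {n : ℕ} (mu lam : n.Partition) : Prop := sortedParts mu < sortedParts lam

lemma lexLT_wellFounded (n : ℕ) : WellFounded (LexLT (n := n)) :=
  haveI : IsTrans n.Partition LexLT := ⟨fun _ _ _ h h' => lt_trans (α := List ℕ) h h'⟩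
  haveI : Std.Irrefl (LexLT (n := n)) := ⟨fun _ => lt_irrefl (α := List ℕ) _⟩
  Finite.wellFounded_of_trans_of_irrefl _

open scoped Classical in
/-- The Macdonald symmetric functions `P_λ(x;q,t)`, constructed from the `m_λ` by Gram–Schmidt
orthogonalization along the lexicographic order (see `macdonaldP_eq`). -/
def macdonaldP {n : ℕ} : n.Partition → SymFun :=
  (lexLT_wellFounded n).fix fun lam P =>
    monomialSym lam - ∑ mu : {mu : n.Partition // LexLT mu lam},
      (macdonaldForm (monomialSym lam) (P mu mu.2) / macdonaldForm (P mu mu.2) (P mu mu.2)) •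
        P mu mu.2

open scoped Classical in
lemma macdonaldP_eq {n : ℕ} (lam : n.Partition) :
    macdonaldP lam = monomialSym lam - ∑ mu : {mu : n.Partition // LexLT mu lam},
      (macdonaldForm (monomialSym lam) (macdonaldP mu.1) /
        macdonaldForm (macdonaldP mu.1) (macdonaldP mu.1)) • macdonaldP mu.1 := by
  rw [macdonaldP, WellFounded.fix_eq]

/-- `Q_λ = b_λ P_λ` with `b_λ = ⟨P_λ,P_λ⟩⁻¹`. -/
def macdonaldQ {n : ℕ} (lam : n.Partition) : SymFun :=
  (macdonaldForm (macdonaldP lam) (macdonaldP lam))⁻¹ • macdonaldP lam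

/-- The coefficients `c_{λμ}` of the expansion `P_λ = ∑_{μ ⊢ n} c_{λμ} g_μ` in the basis
`(g_μ)` of the degree `n` part of `Λ` (`c_{λμ}` is zero unless `μ ≥ λ`). -/
def coeffGtoP {n : ℕ} (lam : n.Partition) : n.Partition → BaseField :=
  Classical.epsilon fun c => macdonaldP lam = ∑ mu, c mu • gSymPart mu

/-! ### Rational functions in `z₁, …, z_n` and the star product -/

/-- The field of rational functions in `n` variables over `ℚ(q,t)`. -/
abbrev RatFun (n : ℕ) : Type := FractionRing (MvPolynomial (Fin n) BaseField)

/-- The variable `z_i` as a rational function. -/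
def zvar {n : ℕ} (i : Fin n) : RatFun n :=
  algebraMap (MvPolynomial (Fin n) BaseField) (RatFun n) (MvPolynomial.X i)

/-- The substitution `f(z₁,…,z_m) ↦ f(z_{e(1)},…,z_{e(m)})` in rational functions, for an
injective map `e` of indices. -/
def substVars {m n : ℕ} (e : Fin m ↪ Fin n) : RatFun m →ₐ[BaseField] RatFun n :=
  IsFractionRing.liftAlgHom (A := MvPolynomial (Fin m) BaseField)
    (g := (IsScalarTower.toAlgHom BaseField (MvPolynomial (Fin n) BaseField) (RatFun n)).comp
      (MvPolynomial.rename e))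
    ((IsFractionRing.injective (MvPolynomial (Fin n) BaseField) (RatFun n)).comp
      (MvPolynomial.rename_injective e e.injective))

/-- `Sym f = (1/n!) ∑_{σ ∈ 𝔖_n} f(z_{σ(1)},…,z_{σ(n)})`. -/
def symmetrize {n : ℕ} (f : RatFun n) : RatFun n :=
  ((n.factorial : BaseField)⁻¹) • ∑ σ : Equiv.Perm (Fin n), substVars σ.toEmbedding f

/-- `ω(x,y) = (x - q₁ y)(x - q₂ y)(x - q₃ y) / (x - y)³` with `q₁ = q⁻¹`, `q₂ = t`,
`q₃ = q t⁻¹`, evaluated at two of the variables. -/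
def omega {n : ℕ} (i j : Fin n) : RatFun n :=
  ((zvar i - q⁻¹ • zvar j) * (zvar i - t • zvar j) * (zvar i - (q * t⁻¹) • zvar j)) /
    (zvar i - zvar j) ^ 3

/-- The star product
`f * g = Sym [f(z₁,…,z_m) g(z_{m+1},…,z_{m+n}) ∏_{α ≤ m < β} ω(z_α,z_β)]`. -/
def star {m n : ℕ} (f : RatFun m) (g : RatFun n) : RatFun (m + n) :=
  symmetrize (substVars (Fin.castAddEmb n) f * substVars (Fin.natAddEmb m) g *
    ∏ i : Fin m, ∏ j : Fin n, omega (Fin.castAdd n i) (Fin.natAdd m j))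

/-- `ε_n(z₁,…,z_n;p) = ∏_{i<j} (z_i - p z_j)(z_i - p⁻¹ z_j) / (z_i - z_j)²`. -/
def epsilonFun (n : ℕ) (p : BaseField) : RatFun n :=
  ∏ i : Fin n, ∏ j ∈ Finset.Ioi i,
    ((zvar i - p • zvar j) * (zvar i - p⁻¹ • zvar j)) / (zvar i - zvar j) ^ 2

/-- `ε_{a₁} * (ε_{a₂} * (⋯ * ε_{a_l}))` for a multi-index `(a₁,…,a_l)`. -/
def epsilonList (p : BaseField) : (l : List ℕ) → RatFun l.sum
  | [] => 1
  | a :: l => star (epsilonFun a p) (epsilonList p l)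

lemma sortedParts_sum {n : ℕ} (lam : n.Partition) : (sortedParts lam).sum = n := by
  rw [← Multiset.sum_coe, sortedParts, Multiset.sort_eq, lam.parts_sum]

/-- `ε_λ(z;p) = ε_{λ₁} * ⋯ * ε_{λ_l}`, as a rational function in `n = |λ|` variables. -/
def epsilonPart {n : ℕ} (lam : n.Partition) (p : BaseField) : RatFun n :=
  substVars (finCongr (sortedParts_sum lam)).toEmbedding (epsilonList p (sortedParts lam))

/-! ### The kernel function -/

/-- The multinomial coefficient `|λ|! / ∏ᵢ λᵢ!`, as a quotient in the base field. -/
def multinom {n : ℕ} (lam : n.Partition) : BaseField :=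
  (n.factorial : BaseField) / (lam.parts.map fun i => (i.factorial : BaseField)).prod

/-- `F_λ(z;q,t) = (-1)^{|λ|} / ((1-q)^{|λ|} |λ|!) ∑_μ c_{λμ} ε_μ(z;t) |μ|! / ∏ μᵢ!`. -/
def macdonaldF {n : ℕ} (lam : n.Partition) : RatFun n :=
  ((-1) ^ n / ((1 - q) ^ n * (n.factorial : BaseField))) •
    ∑ mu : n.Partition, (coeffGtoP lam mu * multinom mu) • epsilonPart mu t

/-- The kernel function `K_n(x,z;q,t) = ∑_{λ ⊢ n} Q_λ(x) F_λ(z;q,t)`. -/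
def kernelK (n : ℕ) : SymFun ⊗[BaseField] RatFun n :=
  ∑ lam : n.Partition, macdonaldQ lam ⊗ₜ[BaseField] macdonaldF lam

end MacdonaldKernel

end

noncomputable section

namespace MacdonaldKernel

/-! ### A real embedding of the base field -/

/-! The kernel identity is linear algebra on two pairs of dual bases of the degree `n` part of
`SymFun`. The `g_μ` are dual to the `m_μ`, so pairing the expansion of `P_λ` with `m_μ` gives
`c_{λμ} = ⟨P_λ, m_μ⟩`. The `Q_λ` are dual to the orthogonal `P_λ`, so `m_μ = ∑_λ c_{λμ} Q_λ`.
Inserting this into the kernel and exchanging the sums gives the formula; the functions `ε_μ` enter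
only as vectors in the second tensor factor. Uniqueness is that of Gram–Schmidt: dominance implies
the lexicographic order, and the form is anisotropic.

The work lies in the form. On polynomials in formal power sums it is diagonal, and anisotropic
because `exists_realEmbedding` makes all monomial norms positive (`polyForm_self_ne_zero`). For the
duality `polyForm_gPolyProd`, the adjoint of multiplication by `p_k` is a derivation sending `g_m`
to `g_{m-k}`. On a product of `g`'s it therefore lowers one index by `k`, exactly as the
coefficients of `p_k f` arise from those of `f`. Induction on the polynomial concludes. Duality and
anisotropy together make the power sums algebraically independent (`powerSumEval_injective`), so the
form exists, and a dimension count puts every homogeneous function in the range of `powerSumEval`,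
where the form is determined. -/

/-- Only countably many reals are algebraic over a countable domain, while the interval is
uncountable. -/
lemma exists_transcendental_mem_Ioo (K : Type*) [CommRing K] [IsDomain K] [Algebra K ℝ]
    [FaithfulSMul K ℝ] [Countable K] : ∃ y : ℝ, y ∈ Set.Ioo (0 : ℝ) 1 ∧ Transcendental K y := by
  by_contra! h
  have : Set.Ioo (0 : ℝ) 1 ⊆ {x | IsAlgebraic K x} := fun y hy => by
    simpa [Transcendental] using h y hy
  have hc := (Algebraic.countable K ℝ).mono this
  rw [← Cardinal.le_aleph0_iff_set_countable, Cardinal.mk_Ioo_real zero_lt_one] at hc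
  exact absurd hc (not_le.mpr Cardinal.aleph0_lt_continuum)

lemma exists_algebraicIndependent_mem_Ioo :
    ∃ f : Fin 2 → ℝ, (∀ i, f i ∈ Set.Ioo (0 : ℝ) 1) ∧ AlgebraicIndependent ℚ f := by
  obtain ⟨x, hx, hxt⟩ := exists_transcendental_mem_Ioo ℚ
  have hx' : AlgebraicIndependent ℚ (fun _ : Unit => x) :=
    algebraicIndependent_unique_type_iff.mpr hxt
  have : Countable (MvPolynomial Unit ℚ) :=
    Cardinal.mk_le_aleph0_iff.mp (MvPolynomial.cardinalMk_le_max.trans (by simp))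
  have : Countable (Algebra.adjoin ℚ (Set.range fun _ : Unit => x)) :=
    hx'.aevalEquiv.symm.injective.countable
  obtain ⟨y, hy, hyt⟩ :=
    exists_transcendental_mem_Ioo (Algebra.adjoin ℚ (Set.range fun _ : Unit => x))
  refine ⟨![y, x], by intro i; fin_cases i <;> simpa, ?_⟩
  have h := (hx'.option_iff_transcendental y).mpr hyt
  have h2 := h.comp (![none, some ()] : Fin 2 → Option Unit) (by
    intro i j; fin_cases i <;> fin_cases j <;> simp)
  convert! h2 using 1
  ext i
  fin_cases i <;> rfl

/-- Algebraic independence of the two images lets the evaluation extend to the fraction field. This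
brings positivity arguments to `BaseField`. -/
lemma exists_realEmbedding :
    ∃ θ : BaseField →+* ℝ, θ q ∈ Set.Ioo (0 : ℝ) 1 ∧ θ t ∈ Set.Ioo (0 : ℝ) 1 := by
  obtain ⟨f, hf, hi⟩ := exists_algebraicIndependent_mem_Ioo
  have hi' : Function.Injective
      (MvPolynomial.aeval f : MvPolynomial (Fin 2) ℚ →ₐ[ℚ] ℝ).toRingHom := hi
  refine ⟨IsFractionRing.lift (A := MvPolynomial (Fin 2) ℚ)
    (g := (MvPolynomial.aeval f : MvPolynomial (Fin 2) ℚ →ₐ[ℚ] ℝ).toRingHom) hi', ?_, ?_⟩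
  · rw [q, IsFractionRing.lift_algebraMap]
    simpa using hf 0
  · rw [t, IsFractionRing.lift_algebraMap]
    simpa using hf 1

lemma one_sub_t_pow_ne_zero (j : ℕ) : (1 : BaseField) - t ^ (j + 1) ≠ 0 := by
  obtain ⟨θ, -, ht⟩ := exists_realEmbedding
  intro h
  have h1 := congrArg θ h
  rw [map_sub, map_pow, map_one, map_zero] at h1
  have := pow_lt_one₀ ht.1.le ht.2 (Nat.add_one_ne_zero j)
  linarith

/-! ### The one-variable series -/

/-- The weight `(1 - tʲ) / (1 - qʲ)`. -/
def wt (j : ℕ) : BaseField := (1 - t ^ j) / (1 - q ^ j)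

lemma wt_ne_zero (j : ℕ) : wt (j + 1) ≠ 0 :=
  div_ne_zero (one_sub_t_pow_ne_zero j) (one_sub_q_pow_ne_zero j)

open PowerSeries in
lemma qPochInf_mul_inv : qPochInf * qPochInf⁻¹ = 1 :=
  PowerSeries.mul_inv_cancel _ (by simp [constantCoeff_qPochInf])

open PowerSeries in
-- Apply `(y;q)_∞ = (1 - y)(qy;q)_∞` to the numerator and to the denominator.
lemma oneVarG_functional :
    (1 - X) * oneVarG = (1 - C t * X) * rescale q oneVarG := by
  have hne : qPochInf ≠ 0 := fun h => by
    have := constantCoeff_qPochInf; simp [h] at this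
  have hq := congrArg (rescale q) qPochInf_mul_inv
  rw [map_mul, map_one] at hq
  have ht : rescale t qPochInf = (1 - C t * X) * rescale q (rescale t qPochInf) := by
    conv_lhs => rw [qPochInf_eq]
    rw [map_mul, map_sub, map_one, rescale_X, rescale_rescale, rescale_rescale, mul_comm q t]
  have h1 := qPochInf_mul_inv
  have h2 := qPochInf_eq
  rw [oneVarG, map_mul]
  conv_lhs => rw [ht]
  have key : (1 - X) * qPochInf⁻¹ = rescale q qPochInf⁻¹ := by
    linear_combination (1 - X) * (-qPochInf⁻¹) * hq +
      rescale q qPochInf⁻¹ * h1 - qPochInf⁻¹ * rescale q qPochInf⁻¹ * h2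
  rw [← key]
  ring

open PowerSeries in
lemma coeff_zero_oneVarG : coeff 0 oneVarG = 1 := by
  rw [oneVarG, coeff_zero_eq_constantCoeff_apply, map_mul,
    ← coeff_zero_eq_constantCoeff_apply, coeff_rescale]
  simp [constantCoeff_qPochInf]

open PowerSeries in
lemma coeff_succ_oneVarG (k : ℕ) :
    (1 - q ^ (k + 1)) * coeff (k + 1) oneVarG = (1 - t * q ^ k) * coeff k oneVarG := by
  have h := congrArg (coeff (k + 1)) oneVarG_functional
  rw [sub_mul, sub_mul, one_mul, one_mul, map_sub, map_sub, coeff_succ_X_mul, mul_assoc,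
    coeff_C_mul, coeff_succ_X_mul, coeff_rescale, coeff_rescale] at h
  linear_combination h

open PowerSeries in
/-- A series without constant term satisfying the functional equation of `oneVarG` vanishes. -/
lemma eq_zero_of_functional {D : PowerSeries BaseField} (h0 : coeff 0 D = 0)
    (h : (1 - X) * D = (1 - C t * X) * rescale q D) : D = 0 := by
  ext n
  induction n with
  | zero => rw [h0, map_zero]
  | succ k ih =>
    have h := congrArg (coeff (k + 1)) h
    rw [sub_mul, sub_mul, one_mul, one_mul, map_sub, map_sub, coeff_succ_X_mul, mul_assoc,
      coeff_C_mul, coeff_succ_X_mul, coeff_rescale, coeff_rescale, ih, map_zero] at h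
    have h2 : (1 - q ^ (k + 1)) * coeff (k + 1) D = 0 := by linear_combination h
    rw [map_zero]
    exact (mul_eq_zero.mp h2).resolve_left (one_sub_q_pow_ne_zero k)

open PowerSeries in
-- This is `y G'(y) = W(y) G(y)` with `W = ∑ wt j yʲ`. Both sides solve the same inhomogeneous
-- `q`-difference equation, obtained for the left side by differentiating `oneVarG_functional`.
lemma mk_natCast_mul_coeff_oneVarG :
    mk (fun d => (d : BaseField) * coeff d oneVarG) = mk wt * oneVarG := by
  set G := oneVarG
  set H := mk (fun d => (d : BaseField) * coeff d G)
  set T : PowerSeries BaseField := mk fun j => 1 - t ^ j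
  -- `T` is `1/(1 - X) - 1/(1 - tX)`.
  have hT : (1 - C t * X) * ((1 - X) * T) = C (1 - t) * X := by
    have e : (1 - X) * T = mk fun j => if j = 0 then 0 else t ^ (j - 1) * (1 - t) := by
      ext n
      cases n with
      | zero => simp [T]
      | succ n =>
        rw [sub_mul, one_mul, map_sub, coeff_succ_X_mul]
        simp [T]; ring
    rw [e]
    ext n
    rcases n with - | - | n
    · simp
    · rw [sub_mul, one_mul, map_sub, mul_assoc, coeff_C_mul, coeff_succ_X_mul, coeff_C_mul]
      simp
    · rw [sub_mul, one_mul, map_sub, mul_assoc, coeff_C_mul, coeff_succ_X_mul, coeff_C_mul,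
        coeff_X]
      simp; ring
  have hS : mk wt = rescale q (mk wt) + T := by
    ext n
    rw [map_add, coeff_rescale, coeff_mk, coeff_mk, wt]
    cases n with
    | zero => simp
    | succ n =>
      have := one_sub_q_pow_ne_zero n
      field_simp
      ring
  have hG := oneVarG_functional
  have hne : (1 - C t * X : PowerSeries BaseField) ≠ 0 := fun h => by
    have := congrArg constantCoeff h
    simp at this
  have hR : (1 - X) * T * G = G - rescale q G := by
    refine mul_left_cancel₀ hne ?_
    rw [map_sub, map_one] at hT
    linear_combination G * hT - hG
  have hH : (1 - X) * H = (1 - C t * X) * rescale q H + (G - rescale q G) := by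
    ext n
    cases n with
    | zero =>
      rw [map_add, sub_mul, sub_mul, one_mul, one_mul, map_sub, map_sub, coeff_zero_X_mul,
        mul_assoc, coeff_C_mul, coeff_zero_X_mul, coeff_rescale, map_sub, coeff_rescale]
      simp only [H, coeff_mk]
      simp
    | succ n =>
      rw [map_add, sub_mul, sub_mul, one_mul, one_mul, map_sub, map_sub, coeff_succ_X_mul,
        mul_assoc, coeff_C_mul, coeff_succ_X_mul, coeff_rescale, coeff_rescale, map_sub,
        coeff_rescale]
      simp only [H, coeff_mk]
      have := coeff_succ_oneVarG n
      push_cast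
      linear_combination (n : BaseField) * this
  -- The inhomogeneous terms `G - rescale q G` cancel in the difference. Its constant term vanishes
  -- because `wt 0` is `0 / 0 = 0`.
  refine sub_eq_zero.mp (eq_zero_of_functional ?_ ?_)
  · simp [H, wt]
  · rw [map_sub, map_mul]
    linear_combination hH - (1 - X) * G * hS - hR - rescale q (mk wt) * hG

/-- The coefficientwise form of the logarithmic derivative of the one-variable series. -/
lemma natCast_mul_coeff_oneVarG (d : ℕ) :
    (d : BaseField) * PowerSeries.coeff d oneVarG =
      ∑ j ∈ Finset.range d, wt (j + 1) * PowerSeries.coeff (d - (j + 1)) oneVarG := by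
  have h := congrArg (PowerSeries.coeff d) mk_natCast_mul_coeff_oneVarG
  rw [PowerSeries.coeff_mk, PowerSeries.coeff_mul,
    Finset.Nat.sum_antidiagonal_eq_sum_range_succ_mk, Finset.sum_range_succ'] at h
  simpa [wt] using h

/-! ### Coefficients of symmetric functions -/

/-- The coefficient of a monomial in a symmetric function. -/
def coeffSym (d : ℕ →₀ ℕ) : SymFun →ₗ[BaseField] BaseField :=
  MvPowerSeries.coeff d ∘ₗ SymFun.val.toLinearMap

lemma coeffSym_apply (d : ℕ →₀ ℕ) (f : SymFun) :
    coeffSym d f = MvPowerSeries.coeff d (f : MvPowerSeries ℕ BaseField) := rfl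

lemma SymFun.ext_coeff {f g : SymFun} (h : ∀ d, coeffSym d f = coeffSym d g) : f = g :=
  Subtype.ext (MvPowerSeries.ext h)

lemma coeffSym_ofExponents (d : ℕ →₀ ℕ) (N : ℕ) (c : Multiset ℕ → BaseField)
    (hc : ∀ s, c s ≠ 0 → s.sum ≤ N) : coeffSym d (ofExponents N c hc) = c (exponents d) := rfl

lemma exponents_eq_singleton_iff (d : ℕ →₀ ℕ) (k : ℕ) :
    exponents d = {k + 1} ↔ ∃ i, d = Finsupp.single i (k + 1) := by
  constructor
  · intro h
    obtain ⟨i, hi, hk⟩ := Multiset.map_eq_singleton.mp h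
    refine ⟨i, ?_⟩
    have hs : d.support = {i} := by rw [← Finset.val_inj, hi]; rfl
    rw [← hk]
    exact Finsupp.eq_single_iff.mpr ⟨hs.le, rfl⟩
  · rintro ⟨i, rfl⟩
    rw [exponents, Finsupp.support_single i (Nat.succ_ne_zero k)]
    simp

lemma coeffSym_powerSum (d : ℕ →₀ ℕ) (k : ℕ) [Decidable (∃ i, d = Finsupp.single i (k + 1))] :
    coeffSym d (powerSum (k + 1)) = if ∃ i, d = Finsupp.single i (k + 1) then 1 else 0 := by
  rw [powerSum, coeffSym_ofExponents]
  simp only [exponents_eq_singleton_iff]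

/-- Each term `x_i^(k+1)` of the power sum reaches the monomial `a` from one monomial at most.
`adjDeriv_gPolyProd` has the same shape on the other side of the duality. -/
lemma coeffSym_powerSum_mul (a : ℕ →₀ ℕ) (k : ℕ) (f : SymFun) :
    coeffSym a (powerSum (k + 1) * f) =
      ∑ i ∈ a.support, if k + 1 ≤ a i then coeffSym (a - Finsupp.single i (k + 1)) f else 0 := by
  classical
  rw [coeffSym_apply, MulMemClass.coe_mul, MvPowerSeries.coeff_mul, ← Finset.sum_filter]
  symm
  refine Finset.sum_of_injOn
    (fun i => (Finsupp.single i (k + 1), a - Finsupp.single i (k + 1))) ?_ ?_ ?_ ?_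
  · intro i _ j _ h
    exact Finsupp.single_left_injective (Nat.succ_ne_zero k) (Prod.ext_iff.mp h).1
  · intro i hi
    have hi' := (Finset.mem_filter.mp hi).2
    simp only [Finset.mem_coe, Finset.HasAntidiagonal.mem_antidiagonal]
    exact add_tsub_cancel_of_le (Finsupp.single_le_iff.mpr hi')
  · rintro ⟨b, c⟩ hbc hne
    rw [Finset.HasAntidiagonal.mem_antidiagonal] at hbc
    dsimp only at hbc ⊢
    rw [← coeffSym_apply, coeffSym_powerSum, if_neg, zero_mul]
    rintro ⟨i, rfl⟩
    refine hne ⟨i, ?_, ?_⟩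
    · have : a i = k + 1 + c i := by rw [← hbc]; simp
      simp only [Finset.coe_filter, Set.mem_ofPred_eq, Finsupp.mem_support_iff]
      omega
    · simp only [← hbc, add_tsub_cancel_left]
  · intro i hi
    dsimp only
    rw [← coeffSym_apply, coeffSym_powerSum, if_pos ⟨i, rfl⟩, one_mul, coeffSym_apply]

/-- Enlarging the support is harmless since the one-variable series has constant term `1`; this
allows a common index set after an exponent drops to zero. -/
lemma coeffSym_gSym (d : ℕ →₀ ℕ) (k : ℕ) {S : Finset ℕ} (hS : d.support ⊆ S) :
    coeffSym d (gSym k) =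
      if d.degree = k then ∏ i ∈ S, PowerSeries.coeff (d i) oneVarG else 0 := by
  rw [gSym, coeffSym_ofExponents, exponents_sum]
  congr 1
  rw [exponents, Multiset.map_map]
  refine Finset.prod_subset hS fun i _ hi => ?_
  rw [Function.comp_apply, Finsupp.notMem_support_iff.mp hi, coeff_zero_oneVarG]

lemma gSym_zero : gSym 0 = 1 := by
  classical
  refine SymFun.ext_coeff fun d => ?_
  rw [coeffSym_gSym d 0 subset_rfl, coeffSym_apply, OneMemClass.coe_one, MvPowerSeries.coeff_one]
  simp only [Finsupp.degree_eq_zero_iff]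
  split_ifs with h
  · simp [h]
  · rfl

/-- The recursion for the `g_m` that comes from the logarithmic derivative of their generating
function. -/
lemma natCast_smul_gSym (m : ℕ) :
    (m : BaseField) • gSym m =
      ∑ j ∈ Finset.range m, wt (j + 1) • (powerSum (j + 1) * gSym (m - (j + 1))) := by
  classical
  refine SymFun.ext_coeff fun d => ?_
  set γ := fun k => PowerSeries.coeff k oneVarG
  have hdeg (i j : ℕ) (h : j + 1 ≤ d i) :
      (d - Finsupp.single i (j + 1)).degree + (j + 1) = d.degree := by
    conv_rhs => rw [← tsub_add_cancel_of_le (Finsupp.single_le_iff.mpr h), map_add,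
      Finsupp.degree_single]
  rw [map_smul, map_sum]
  simp only [map_smul, coeffSym_powerSum_mul, smul_eq_mul]
  by_cases hd : d.degree = m
  · have hterm : ∀ j ∈ Finset.range m, ∀ i ∈ d.support,
        (if j + 1 ≤ d i then coeffSym (d - Finsupp.single i (j + 1)) (gSym (m - (j + 1))) else 0) =
        (if j ∈ Finset.range (d i) then
          γ (d i - (j + 1)) * ∏ i' ∈ d.support.erase i, γ (d i') else 0) := by
      intro j hj i hi
      refine if_ctx_congr (by rw [Finset.mem_range, Nat.lt_iff_add_one_le]) (fun h => ?_) fun _ => rfl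
      have h := Nat.lt_iff_add_one_le.mp (Finset.mem_range.mp h)
      have := hdeg i j h
      rw [coeffSym_gSym _ _ (Finsupp.support_tsub : _ ⊆ d.support), if_pos (by omega),
        ← Finset.mul_prod_erase _ _ hi]
      congr 1
      · simp [γ]
      · refine Finset.prod_congr rfl fun i' hi' => ?_
        simp [γ, Finsupp.single_eq_of_ne (Finset.ne_of_mem_erase hi')]
    rw [Finset.sum_congr rfl fun j hj => congrArg (wt (j + 1) * ·)
      (Finset.sum_congr rfl (hterm j hj))]
    simp only [Finset.mul_sum]
    rw [Finset.sum_comm, coeffSym_gSym d m subset_rfl, if_pos hd]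
    -- For each variable, the sum over `j` is the one-variable recursion and produces the factor `d
    -- i`; these factors add up to the degree `m`.
    have hi : ∀ i ∈ d.support, ∑ j ∈ Finset.range m, wt (j + 1) *
        (if j ∈ Finset.range (d i) then
          γ (d i - (j + 1)) * ∏ i' ∈ d.support.erase i, γ (d i') else 0) =
        (d i : BaseField) * ∏ i' ∈ d.support, γ (d i') := by
      intro i hi
      have hle : d i ≤ m := hd ▸ Finsupp.le_degree i d
      rw [← Finset.mul_prod_erase _ _ hi, ← mul_assoc, natCast_mul_coeff_oneVarG, Finset.sum_mul]
      simp only [mul_ite, mul_zero, ← Finset.sum_filter, Finset.filter_mem_eq_inter]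
      rw [Finset.inter_eq_right.mpr (Finset.range_subset_range.mpr hle)]
      exact Finset.sum_congr rfl fun j _ => by ring
    rw [Finset.sum_congr rfl hi, ← Finset.sum_mul, ← Nat.cast_sum, ← hd]
    rfl
  · rw [coeffSym_gSym d m subset_rfl, if_neg hd, mul_zero]
    refine (Finset.sum_eq_zero fun j hj => ?_).symm
    rw [Finset.sum_eq_zero, mul_zero]
    intro i _
    split_ifs with h
    · have := hdeg i j h
      have hj := Finset.mem_range.mp hj
      rw [coeffSym_gSym _ _ subset_rfl, if_neg (by omega)]
    · rfl

/-! ### Permutation invariance and homogeneous components -/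

/-- Match the fibres of `d` and `e` over each value and glue: over a non-zero value they are finite
of equal size, over zero both are countably infinite. -/
lemma exists_perm_of_exponents_eq {d e : ℕ →₀ ℕ} (h : exponents d = exponents e) :
    ∃ σ : Equiv.Perm ℕ, e = d.embDomain σ.toEmbedding := by
  classical
  have hfib (v : ℕ) : Nonempty ({i // d i = v} ≃ {i // e i = v}) := by
    rcases Nat.eq_zero_or_pos v with rfl | hv
    · have hinf (f : ℕ →₀ ℕ) : Infinite {i // f i = 0} := by
        have : {i | f i = 0} = (f.support : Set ℕ)ᶜ := by ext; simp
        have h : ({i | f i = 0} : Set ℕ).Infinite := by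
          rw [this]; exact f.support.finite_toSet.infinite_compl
        exact h.to_subtype
      have := hinf d
      have := hinf e
      exact Cardinal.eq.mp (by rw [Cardinal.mk_eq_aleph0, Cardinal.mk_eq_aleph0])
    · have hset (f : ℕ →₀ ℕ) : {i | f i = v} = (f.support.filter fun i => v = f i : Finset ℕ) := by
        ext i
        simp only [Set.mem_ofPred_eq, Finset.coe_filter, Finsupp.mem_support_iff]
        omega
      have hcard (f : ℕ →₀ ℕ) : Nat.card {i // f i = v} = (exponents f).count v := by
        rw [exponents, Multiset.count_map]
        exact (congrArg Set.ncard (hset f)).trans (Set.ncard_coe_finset _)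
      have hfin (f : ℕ →₀ ℕ) : Finite {i // f i = v} := by
        have h : ({i | f i = v} : Set ℕ).Finite := by
          rw [hset]; exact Finset.finite_toSet _
        exact h.to_subtype
      have := hfin d
      have := hfin e
      exact Finite.card_eq.mp (by rw [hcard, hcard, h])
  let ψ v := (hfib v).some
  refine ⟨Equiv.ofFiberEquiv ψ, Finsupp.ext fun i => ?_⟩
  obtain ⟨j, rfl⟩ := (Equiv.ofFiberEquiv ψ).surjective i
  exact (Equiv.ofFiberEquiv_map ψ j).trans
    (Finsupp.embDomain_apply_self (Equiv.ofFiberEquiv ψ).toEmbedding d j).symm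

/-- The coefficient of a monomial in a symmetric function depends only on its exponents. -/
lemma coeffSym_congr (f : SymFun) {d e : ℕ →₀ ℕ} (h : exponents d = exponents e) :
    coeffSym d f = coeffSym e f := by
  obtain ⟨σ, rfl⟩ := exists_perm_of_exponents_eq h
  have h1 := congrArg (MvPowerSeries.coeff (d.embDomain σ.toEmbedding)) (f.2.1 σ)
  exact (MvPowerSeries.coeff_embDomain_rename σ.toEmbedding _ d).symm.trans h1

lemma exists_exponents_eq (s : Multiset ℕ) (hs : 0 ∉ s) : ∃ d : ℕ →₀ ℕ, exponents d = s := by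
  classical
  induction s using Multiset.induction with
  | empty => exact ⟨0, rfl⟩
  | cons k s ih =>
    rw [Multiset.mem_cons, not_or] at hs
    obtain ⟨d, rfl⟩ := ih hs.2
    obtain ⟨i, hi⟩ := Infinite.exists_notMem_finset d.support
    have hd : Disjoint (Finsupp.single i k).support d.support := by
      rw [Finsupp.support_single i (Ne.symm hs.1)]
      exact Finset.disjoint_singleton_left.mpr hi
    refine ⟨Finsupp.single i k + d, ?_⟩
    rw [exponents, Finsupp.support_add_eq hd, Finsupp.support_single i (Ne.symm hs.1),
      ← Finset.insert_eq, Finset.insert_val_of_notMem hi, Multiset.map_cons]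
    congr 1
    · simp [Finsupp.notMem_support_iff.mp hi]
    · refine Multiset.map_congr rfl fun j hj => ?_
      have : j ≠ i := fun h => hi (h ▸ hj)
      simp [Finsupp.single_eq_of_ne this]

lemma zero_notMem_exponents (d : ℕ →₀ ℕ) : 0 ∉ exponents d := by
  rw [exponents, Multiset.mem_map]
  rintro ⟨i, hi, h⟩
  exact (Finsupp.mem_support_iff.mp hi) h

lemma zero_notMem_parts {n : ℕ} (lam : n.Partition) : 0 ∉ lam.parts := fun h =>
  lt_irrefl 0 (lam.parts_pos h)

/-- A monomial whose exponents are the parts of a given partition. -/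
def partExp {n : ℕ} (lam : n.Partition) : ℕ →₀ ℕ :=
  (exists_exponents_eq lam.parts (zero_notMem_parts lam)).choose

lemma exponents_partExp {n : ℕ} (lam : n.Partition) : exponents (partExp lam) = lam.parts :=
  (exists_exponents_eq lam.parts (zero_notMem_parts lam)).choose_spec

/-- The homogeneous symmetric functions of degree `n`. -/
def homogSym (n : ℕ) : Submodule BaseField SymFun where
  carrier := {f | ∀ d, coeffSym d f ≠ 0 → d.degree = n}
  zero_mem' := fun d hd => absurd (map_zero _) hd
  add_mem' := by
    intro f g hf hg d hd
    by_cases h : coeffSym d f = 0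
    · exact hg d (by rwa [map_add, h, zero_add] at hd)
    · exact hf d h
  smul_mem' := by
    intro c f hf d hd
    rw [map_smul] at hd
    exact hf d (right_ne_zero_of_smul hd)

lemma mul_mem_homogSym {m n : ℕ} {f g : SymFun} (hf : f ∈ homogSym m) (hg : g ∈ homogSym n) :
    f * g ∈ homogSym (m + n) := by
  intro d hd
  rw [coeffSym_apply, MulMemClass.coe_mul, MvPowerSeries.coeff_mul] at hd
  obtain ⟨⟨a, b⟩, hab, h⟩ := Finset.exists_ne_zero_of_sum_ne_zero hd
  have hab' : a + b = d := by simpa using hab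
  rw [← hab', map_add, hf a (left_ne_zero_of_mul h), hg b (right_ne_zero_of_mul h)]

lemma one_mem_homogSym : (1 : SymFun) ∈ homogSym 0 := by
  rw [← gSym_zero]
  intro d hd
  rw [coeffSym_gSym d 0 subset_rfl] at hd
  by_contra h
  simp [h] at hd

lemma multiset_prod_mem_homogSym {f : ℕ → SymFun} (s : Multiset ℕ)
    (hf : ∀ k ∈ s, f k ∈ homogSym k) : (s.map f).prod ∈ homogSym s.sum := by
  induction s using Multiset.induction with
  | empty => exact one_mem_homogSym
  | cons k s ih =>
    rw [Multiset.map_cons, Multiset.prod_cons, Multiset.sum_cons]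
    exact mul_mem_homogSym (hf k (Multiset.mem_cons_self k s))
      (ih fun j hj => hf j (Multiset.mem_cons_of_mem hj))

lemma powerSumPart_mem_homogSym {n : ℕ} (lam : n.Partition) : powerSumPart lam ∈ homogSym n := by
  have h := multiset_prod_mem_homogSym (f := powerSum) lam.parts fun k _ d hd => by
    rw [powerSum, coeffSym_ofExponents] at hd
    by_contra h
    refine hd (if_neg fun h' => h ?_)
    rw [← exponents_sum, h', Multiset.sum_singleton]
  rwa [lam.parts_sum] at h

lemma gSymPart_mem_homogSym {n : ℕ} (lam : n.Partition) : gSymPart lam ∈ homogSym n := by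
  have h := multiset_prod_mem_homogSym (f := gSym) lam.parts fun k _ d hd => by
    rw [coeffSym_gSym d k subset_rfl] at hd
    by_contra h
    exact hd (if_neg h)
  rwa [lam.parts_sum] at h

lemma coeffSym_monomialSym {n : ℕ} (d : ℕ →₀ ℕ) (lam : n.Partition) :
    coeffSym d (monomialSym lam) = if exponents d = lam.parts then 1 else 0 := rfl

lemma coeffSym_partExp_monomialSym {n : ℕ} [DecidableEq n.Partition] (mu lam : n.Partition) :
    coeffSym (partExp mu) (monomialSym lam) = if mu = lam then 1 else 0 := by
  rw [coeffSym_monomialSym, exponents_partExp]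
  simp only [Nat.Partition.ext_iff]

lemma monomialSym_mem_homogSym {n : ℕ} (lam : n.Partition) : monomialSym lam ∈ homogSym n := by
  intro d hd
  rw [coeffSym_monomialSym] at hd
  by_contra h
  refine hd (if_neg fun h' => h ?_)
  rw [← exponents_sum, h', lam.parts_sum]

/-- A homogeneous symmetric function is determined by its coefficients at partitions. -/
lemma homogSym_ext {n : ℕ} {f g : SymFun} (hf : f ∈ homogSym n) (hg : g ∈ homogSym n)
    (h : ∀ lam : n.Partition, coeffSym (partExp lam) f = coeffSym (partExp lam) g) : f = g := by
  refine SymFun.ext_coeff fun d => ?_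
  by_cases hd : d.degree = n
  · let lam : n.Partition := ⟨exponents d, fun {i} hi => Nat.pos_of_ne_zero fun h0 =>
      zero_notMem_exponents d (h0 ▸ hi), hd⟩
    have he : exponents d = exponents (partExp lam) := (exponents_partExp lam).symm
    rw [coeffSym_congr f he, coeffSym_congr g he, h]
  · rw [not_imp_comm.mp (hf d) hd, not_imp_comm.mp (hg d) hd]

/-- The expansion of a homogeneous symmetric function in monomial symmetric functions. -/
lemma eq_sum_monomialSym {n : ℕ} {f : SymFun} (hf : f ∈ homogSym n) :
    f = ∑ lam : n.Partition, coeffSym (partExp lam) f • monomialSym lam := by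
  classical
  refine homogSym_ext hf
    (Submodule.sum_mem _ fun lam _ => Submodule.smul_mem _ _ (monomialSym_mem_homogSym lam)) ?_
  intro mu
  simp [coeffSym_partExp_monomialSym]

section PowerSumRing

open MvPolynomial

/-! ### The polynomial ring in the power sums and its scalar product -/

/-- The polynomial ring over `ℚ(q,t)` whose variable `X i` stands for the power sum `p_{i+1}`. -/
abbrev PowerSumRing : Type := MvPolynomial ℕ BaseField

/-- The squared norm of the variable that stands for `p_{i+1}`. -/
def varNorm (i : ℕ) : BaseField := (i + 1 : ℕ) / wt (i + 1)

/-- The squared norm of a monomial in the power sums. -/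
def monomialNorm (d : ℕ →₀ ℕ) : BaseField :=
  d.prod fun i m => varNorm i ^ m * (m.factorial : BaseField)

lemma monomialNorm_single_add (k : ℕ) (d : ℕ →₀ ℕ) :
    monomialNorm (Finsupp.single k 1 + d) = varNorm k * (d k + 1) * monomialNorm d := by
  have h0 : ∀ i, varNorm i ^ 0 * ((0 : ℕ).factorial : BaseField) = 1 := by simp
  rw [monomialNorm, monomialNorm, ← Finsupp.mul_prod_erase' _ k _ h0,
    ← Finsupp.mul_prod_erase' d k _ h0, Finsupp.erase_add, Finsupp.erase_single, zero_add,
    Finsupp.add_apply, Finsupp.single_eq_same, add_comm 1, Nat.factorial_succ]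
  push_cast
  ring

/-- Macdonald's scalar product on polynomials in the power sums. -/
def polyForm : LinearMap.BilinForm BaseField PowerSumRing :=
  (basisMonomials ℕ BaseField).constr BaseField fun d => monomialNorm d • lcoeff BaseField d

lemma polyForm_monomial (d : ℕ →₀ ℕ) (c : BaseField) (g : PowerSumRing) :
    polyForm (monomial d c) g = c * (monomialNorm d * coeff d g) := by
  have h : monomial d c = c • basisMonomials ℕ BaseField d := by
    rw [coe_basisMonomials, smul_monomial, smul_eq_mul, mul_one]
  rw [h, polyForm, map_smul, Module.Basis.constr_basis]
  rfl

lemma polyForm_comm (f g : PowerSumRing) : polyForm f g = polyForm g f := by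
  classical
  induction f using MvPolynomial.induction_on' with
  | add f₁ f₂ h₁ h₂ => rw [map_add, LinearMap.add_apply, h₁, h₂, map_add]
  | monomial d c =>
    induction g using MvPolynomial.induction_on' with
    | add g₁ g₂ h₁ h₂ => rw [map_add, h₁, h₂, map_add, LinearMap.add_apply]
    | monomial e c' =>
      rw [polyForm_monomial, polyForm_monomial, coeff_monomial, coeff_monomial]
      by_cases h : d = e
      · subst h; simp; ring
      · rw [if_neg h, if_neg (Ne.symm h)]; simp

/-- The derivation adjoint to multiplication by the power sum `p_{k+1}`. -/
def adjDeriv (k : ℕ) : Derivation BaseField PowerSumRing PowerSumRing := varNorm k • pderiv k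

/-- Raising the exponent of `X k` multiplies the norm by `varNorm k * (d k + 1)`, which is the
factor produced by the scaled partial derivative. -/
lemma polyForm_X_mul (k : ℕ) (f g : PowerSumRing) :
    polyForm (X k * f) g = polyForm f (adjDeriv k g) := by
  induction f using MvPolynomial.induction_on' with
  | add f₁ f₂ h₁ h₂ =>
    rw [mul_add, map_add, LinearMap.add_apply, h₁, h₂, map_add, LinearMap.add_apply]
  | monomial d c =>
    rw [X, monomial_mul, one_mul, polyForm_monomial, polyForm_monomial, monomialNorm_single_add,
      adjDeriv, Derivation.smul_apply, coeff_smul, coeff_pderiv, add_comm d, smul_eq_mul]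
    ring

/-- Monomials are orthogonal, so under a real embedding with `q`, `t` in `(0,1)` the value becomes a
sum of squares with positive weights. -/
lemma polyForm_self_ne_zero {f : PowerSumRing} (hf : f ≠ 0) : polyForm f f ≠ 0 := by
  obtain ⟨θ, hq, ht⟩ := exists_realEmbedding
  have hv (i : ℕ) : 0 < θ (varNorm i) := by
    have h1 : 0 < 1 - θ q ^ (i + 1) := sub_pos.mpr (pow_lt_one₀ hq.1.le hq.2 i.add_one_ne_zero)
    have h2 : 0 < 1 - θ t ^ (i + 1) := sub_pos.mpr (pow_lt_one₀ ht.1.le ht.2 i.add_one_ne_zero)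
    rw [varNorm, wt, map_div₀, map_div₀, map_natCast, map_sub, map_sub, map_pow, map_pow, map_one]
    positivity
  have hn (d : ℕ →₀ ℕ) : 0 < θ (monomialNorm d) := by
    rw [monomialNorm, map_finsuppProd]
    refine Finset.prod_pos fun i _ => ?_
    dsimp only
    rw [map_mul, map_pow, map_natCast]
    exact mul_pos (pow_pos (hv i) _) (by positivity)
  have hsum : polyForm f f = ∑ d ∈ f.support, coeff d f * (monomialNorm d * coeff d f) := by
    conv_lhs => enter [1, 2]; rw [f.as_sum]
    rw [map_sum, LinearMap.sum_apply]
    exact Finset.sum_congr rfl fun d _ => polyForm_monomial _ _ _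
  intro h
  have h0 := congrArg θ (hsum.symm.trans h)
  rw [map_sum, map_zero] at h0
  refine (Finset.sum_pos (fun d hd => ?_) (support_nonempty.mpr hf)).ne' h0
  have hc : θ (coeff d f) ≠ 0 := (map_ne_zero θ).mpr (mem_support_iff.mp hd)
  rw [map_mul, map_mul]
  have := mul_pos (hn d) (pow_two_pos_of_ne_zero hc)
  nlinarith

/-- The evaluation of polynomials at the power sums. -/
def powerSumEval : PowerSumRing →ₐ[BaseField] SymFun := aeval fun i => powerSum (i + 1)

/-- The polynomial in the power sums that represents `g_m`. -/
def gPoly : ℕ → PowerSumRing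
  | 0 => 1
  | m + 1 => ((m + 1 : ℕ) : BaseField)⁻¹ •
      ∑ j : Fin (m + 1), wt (j + 1) • (X (j : ℕ) * gPoly (m - j))

lemma natCast_smul_gPoly (m : ℕ) :
    (m : BaseField) • gPoly m =
      ∑ j ∈ Finset.range m, wt (j + 1) • (X j * gPoly (m - (j + 1))) := by
  cases m with
  | zero => simp
  | succ m =>
    rw [gPoly, smul_inv_smul₀ (Nat.cast_ne_zero.mpr m.succ_ne_zero),
      Finset.sum_range fun j => wt (j + 1) • (X j * gPoly (m + 1 - (j + 1)))]
    simp

lemma powerSumEval_gPoly (m : ℕ) : powerSumEval (gPoly m) = gSym m := by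
  induction m using Nat.strong_induction_on with
  | _ m ih =>
    cases m with
    | zero => rw [gPoly, map_one, gSym_zero]
    | succ m =>
      have hm : ((m + 1 : ℕ) : BaseField) ≠ 0 := Nat.cast_ne_zero.mpr m.succ_ne_zero
      refine smul_right_injective SymFun hm ?_
      dsimp only
      rw [natCast_smul_gSym, ← map_smul, natCast_smul_gPoly, map_sum]
      refine Finset.sum_congr rfl fun j hj => ?_
      rw [map_smul, map_mul, ih _ (by omega), powerSumEval, aeval_X]

lemma varNorm_mul_wt (k : ℕ) : wt (k + 1) * varNorm k = ((k + 1 : ℕ) : BaseField) :=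
  mul_div_cancel₀ _ (wt_ne_zero k)

lemma adjDeriv_X (k j : ℕ) :
    adjDeriv k (X j) = if j = k then C (varNorm k) else 0 := by
  rw [adjDeriv, Derivation.smul_apply]
  split_ifs with h
  · rw [h, pderiv_X_self, smul_eq_C_mul, mul_one]
  · rw [pderiv_X_of_ne h, smul_zero]

/-- Formally `∑ g_m yᵐ = exp (∑ wt j p_j yʲ / j)`, and the normalization of `adjDeriv k` makes it
act on this series as multiplication by `y^(k+1)`. -/
lemma adjDeriv_gPoly (k m : ℕ) :
    adjDeriv k (gPoly m) = if k + 1 ≤ m then gPoly (m - (k + 1)) else 0 := by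
  induction m using Nat.strong_induction_on with
  | _ m ih =>
    rcases Nat.eq_zero_or_pos m with rfl | hm
    · rw [gPoly, Derivation.map_one_eq_zero, if_neg (by omega)]
    · have hm' : (m : BaseField) ≠ 0 := Nat.cast_ne_zero.mpr hm.ne'
      refine smul_right_injective PowerSumRing hm' ?_
      dsimp only
      rw [← Derivation.map_smul, natCast_smul_gPoly, map_sum]
      -- By Leibniz, differentiating `X j` contributes `k + 1` copies of `gPoly (m - (k + 1))`, only
      -- at `j = k`. The other terms form the recursion for that same polynomial and contribute `m -
      -- (k + 1)` copies, `m` in all when `k + 1 ≤ m`.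
      have hterm : ∀ j ∈ Finset.range m, adjDeriv k (wt (j + 1) • (X j * gPoly (m - (j + 1)))) =
          (if j = k then ((k + 1 : ℕ) : BaseField) • gPoly (m - (k + 1)) else 0) +
          (if j ∈ Finset.range (m - (k + 1)) then
            wt (j + 1) • (X j * gPoly (m - (k + 1) - (j + 1))) else 0) := by
        intro j hj
        have hj := Finset.mem_range.mp hj
        rw [Derivation.map_smul, Derivation.leibniz, ih _ (by omega), adjDeriv_X, smul_add,
          add_comm]
        congr 1
        · split_ifs with h
          · subst h
            rw [← varNorm_mul_wt, mul_smul, smul_eq_mul, mul_comm, smul_eq_C_mul _ (varNorm j)]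
          · simp
        · simp only [Finset.mem_range]
          by_cases h : k + 1 ≤ m - (j + 1)
          · rw [if_pos h, if_pos (by omega), smul_eq_mul]
            congr 3
            omega
          · rw [if_neg h, if_neg (by omega), smul_zero, smul_zero]
      rw [Finset.sum_congr rfl hterm, Finset.sum_add_distrib, Finset.sum_ite_eq',
        ← Finset.sum_filter, Finset.filter_mem_eq_inter, Finset.inter_eq_right.mpr
          (Finset.range_subset_range.mpr (Nat.sub_le _ _)), ← natCast_smul_gPoly]
      by_cases h : k + 1 ≤ m
      · rw [if_pos (Finset.mem_range.mpr h), if_pos h, ← add_smul, ← Nat.cast_add,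
          Nat.add_sub_cancel' h]
      · rw [if_neg (by rwa [Finset.mem_range]), if_neg h, Nat.sub_eq_zero_of_le (by omega)]
        simp

/-! ### Products of the `g_m` and coefficient extraction -/

lemma derivation_prod {R A ι : Type*} [CommRing R] [CommRing A] [Algebra R A]
    [DecidableEq ι] (D : Derivation R A A) (s : Finset ι) (f : ι → A) :
    D (∏ i ∈ s, f i) = ∑ i ∈ s, D (f i) * ∏ j ∈ s.erase i, f j := by
  induction s using Finset.induction with
  | empty => simp
  | insert a s ha ih =>
    rw [Finset.prod_insert ha, Derivation.leibniz, ih, Finset.sum_insert ha,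
      Finset.erase_insert ha, smul_eq_mul, smul_eq_mul, add_comm, mul_comm, Finset.mul_sum]
    congr 1
    refine Finset.sum_congr rfl fun i hi => ?_
    rw [Finset.erase_insert_of_ne (fun h : a = i => ha (h ▸ hi)),
      Finset.prod_insert fun h => ha (Finset.mem_of_mem_erase h)]
    ring

/-- The product of the `g_m` over the exponents of a monomial, as a polynomial in the power
sums. -/
def gPolyProd (a : ℕ →₀ ℕ) : PowerSumRing := ∏ i ∈ a.support, gPoly (a i)

lemma gPolyProd_eq_prod {a : ℕ →₀ ℕ} {S : Finset ℕ} (h : a.support ⊆ S) :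
    gPolyProd a = ∏ i ∈ S, gPoly (a i) :=
  Finset.prod_subset h fun i _ hi => by rw [Finsupp.notMem_support_iff.mp hi, gPoly]

lemma gPolyProd_eq_multiset_prod (a : ℕ →₀ ℕ) :
    gPolyProd a = ((exponents a).map gPoly).prod := by
  rw [exponents, Multiset.map_map]; rfl

lemma adjDeriv_gPolyProd (k : ℕ) (a : ℕ →₀ ℕ) :
    adjDeriv k (gPolyProd a) =
      ∑ i ∈ a.support, if k + 1 ≤ a i then gPolyProd (a - Finsupp.single i (k + 1)) else 0 := by
  classical
  rw [gPolyProd, derivation_prod]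
  refine Finset.sum_congr rfl fun i hi => ?_
  rw [adjDeriv_gPoly]
  split_ifs with h
  · rw [gPolyProd_eq_prod (Finsupp.support_tsub : _ ⊆ a.support), ← Finset.mul_prod_erase _ _ hi]
    congr 1
    · simp
    · refine Finset.prod_congr rfl fun j hj => ?_
      simp [Finsupp.single_eq_of_ne (Finset.ne_of_mem_erase hj)]
  · rw [zero_mul]

/-- Pairing with a product of the `g_m` extracts the coefficient of a monomial. -/
theorem polyForm_gPolyProd (a : ℕ →₀ ℕ) (f : PowerSumRing) :
    polyForm (gPolyProd a) f = coeffSym a (powerSumEval f) := by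
  classical
  induction f using MvPolynomial.induction_on generalizing a with
  | C c =>
    -- Pairing with a constant sees only the constant term, which vanishes for each `g_m` with `m >
    -- 0`.
    have h0 (m : ℕ) (hm : m ≠ 0) : constantCoeff (gPoly m) = 0 := by
      have h := congrArg constantCoeff (natCast_smul_gPoly m)
      rw [map_sum, constantCoeff_smul] at h
      simp only [constantCoeff_smul, map_mul, constantCoeff_X, zero_mul, smul_zero,
        Finset.sum_const_zero] at h
      exact (smul_eq_zero.mp h).resolve_left (Nat.cast_ne_zero.mpr hm)
    rw [polyForm_comm, C_apply, polyForm_monomial, ← C_apply, powerSumEval, aeval_C,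
      coeffSym_apply, Algebra.algebraMap_eq_smul_one]
    have h1 : coeffSym a (1 : SymFun) = if a = 0 then 1 else 0 := by
      rw [coeffSym_apply, OneMemClass.coe_one, MvPowerSeries.coeff_one]
    rw [← coeffSym_apply, map_smul, h1, ← constantCoeff_eq]
    by_cases ha : a = 0
    · subst ha
      simp [gPolyProd, monomialNorm]
    · obtain ⟨i, hi⟩ := Finsupp.support_nonempty_iff.mpr ha
      rw [gPolyProd, map_prod,
        Finset.prod_eq_zero hi (h0 _ (Finsupp.mem_support_iff.mp hi)), if_neg ha]
      simp
  | add f g hf hg => rw [map_add, map_add, map_add, hf, hg]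
  | mul_X f k ih =>
    -- Moving `X k` across the form lowers one exponent of `a` by `k + 1`, just as on the
    -- coefficient side, so the two sums agree termwise by induction.
    rw [polyForm_comm, mul_comm, polyForm_X_mul, polyForm_comm, adjDeriv_gPolyProd, map_mul,
      powerSumEval, aeval_X, coeffSym_powerSum_mul, map_sum, LinearMap.sum_apply]
    refine Finset.sum_congr rfl fun i _ => ?_
    split_ifs
    · exact ih _
    · simp

/-! ### The power sums are algebraically independent and generate -/

/-- The last term of the recursion for `gPoly (k + 1)` is `wt (k + 1) • X k`, with non-zero weight,
so one can solve for `X k`. -/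
lemma X_mem_adjoin_gPoly (k : ℕ) :
    (X k : PowerSumRing) ∈ Algebra.adjoin BaseField (Set.range gPoly) := by
  induction k using Nat.strong_induction_on with
  | _ k ih =>
    have hg (m : ℕ) : gPoly m ∈ Algebra.adjoin BaseField (Set.range gPoly) :=
      Algebra.subset_adjoin ⟨m, rfl⟩
    have h := natCast_smul_gPoly (k + 1)
    rw [Finset.sum_range_succ, Nat.sub_self, gPoly, mul_one] at h
    have h' : (X k : PowerSumRing) = (wt (k + 1))⁻¹ • (((k + 1 : ℕ) : BaseField) • gPoly (k + 1) -
        ∑ j ∈ Finset.range k, wt (j + 1) • (X j * gPoly (k + 1 - (j + 1)))) := by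
      rw [h, add_sub_cancel_left, inv_smul_smul₀ (wt_ne_zero k)]
    rw [h']
    refine Subalgebra.smul_mem _ (Subalgebra.sub_mem _ (Subalgebra.smul_mem _ (hg _) _)
      (Subalgebra.sum_mem _ fun j hj => Subalgebra.smul_mem _ (Subalgebra.mul_mem _
        (ih j (Finset.mem_range.mp hj)) (hg _)) _)) _

lemma adjoin_gPoly : Algebra.adjoin BaseField (Set.range gPoly) = ⊤ := by
  rw [eq_top_iff, ← adjoin_range_X, Algebra.adjoin_le_iff]
  rintro _ ⟨k, rfl⟩
  exact X_mem_adjoin_gPoly k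

lemma span_gPolyProd : Submodule.span BaseField (Set.range gPolyProd) = ⊤ := by
  rw [eq_top_iff, ← Algebra.top_toSubmodule, ← adjoin_gPoly, Algebra.adjoin_eq_span,
    Submodule.span_le]
  intro f hf
  -- Factors `gPoly 0 = 1` are dropped, since multisets of exponents never contain zero.
  obtain ⟨s, hs, rfl⟩ : ∃ s : Multiset ℕ, 0 ∉ s ∧ (s.map gPoly).prod = f := by
    induction hf using Submonoid.closure_induction with
    | mem x hx =>
      obtain ⟨m, rfl⟩ := hx
      rcases Nat.eq_zero_or_pos m with rfl | hm
      · exact ⟨0, by simp, by simp [gPoly]⟩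
      · exact ⟨{m}, by simpa using hm.ne, by simp⟩
    | one => exact ⟨0, by simp, by simp⟩
    | mul x y _ _ hx hy =>
      obtain ⟨s, hs, rfl⟩ := hx
      obtain ⟨s', hs', rfl⟩ := hy
      exact ⟨s + s', by simp [hs, hs'], by simp⟩
  obtain ⟨a, rfl⟩ := exists_exponents_eq s hs
  exact Submodule.subset_span ⟨a, gPolyProd_eq_multiset_prod a⟩

/-- By `polyForm_gPolyProd`, an element of the kernel is orthogonal to all products of the `g_m`.
These span, so it is orthogonal to itself and vanishes. -/
lemma powerSumEval_injective : Function.Injective powerSumEval := by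
  rw [injective_iff_map_eq_zero]
  intro f hf
  by_contra hne
  refine polyForm_self_ne_zero hne ?_
  have h : ∀ g ∈ Submodule.span BaseField (Set.range gPolyProd), polyForm g f = 0 := by
    intro g hg
    induction hg using Submodule.span_induction with
    | mem x hx =>
      obtain ⟨a, rfl⟩ := hx
      rw [polyForm_gPolyProd, hf, map_zero]
    | zero => simp
    | add x y _ _ hx hy => rw [map_add, LinearMap.add_apply, hx, hy, add_zero]
    | smul c x _ hx => rw [map_smul, LinearMap.smul_apply, hx, smul_zero]
  exact h f (span_gPolyProd ▸ Submodule.mem_top)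

/-- The multiset of the indices of the power sums in a monomial. -/
def indexMultiset (d : ℕ →₀ ℕ) : Multiset ℕ := (Finsupp.toMultiset d).map Nat.succ

lemma indexMultiset_injective : Function.Injective indexMultiset :=
  (Multiset.map_injective Nat.succ_injective).comp fun d e h => by
    simpa using congrArg Multiset.toFinsupp h

lemma powerSumEval_monomial (d : ℕ →₀ ℕ) :
    powerSumEval (monomial d 1) = ((indexMultiset d).map powerSum).prod := by
  rw [powerSumEval, aeval_monomial, map_one, one_mul, indexMultiset, Multiset.map_map,
    Finsupp.toMultiset_map, Finsupp.prod_toMultiset,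
    Finsupp.prod_mapDomain_index (fun _ => pow_zero _) (fun _ _ _ => pow_add _ _ _)]
  rfl

/-- The monomial in the power sums that belongs to a partition. -/
def partMonomial {n : ℕ} (lam : n.Partition) : ℕ →₀ ℕ :=
  Multiset.toFinsupp (lam.parts.map Nat.pred)

lemma indexMultiset_partMonomial {n : ℕ} (lam : n.Partition) :
    indexMultiset (partMonomial lam) = lam.parts := by
  rw [indexMultiset, partMonomial, Multiset.toFinsupp_toMultiset, Multiset.map_map]
  conv_rhs => rw [← Multiset.map_id lam.parts]
  exact Multiset.map_congr rfl fun i hi => Nat.succ_pred_eq_of_pos (lam.parts_pos hi)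

lemma partMonomial_injective (n : ℕ) :
    Function.Injective (partMonomial : n.Partition → ℕ →₀ ℕ) := fun lam mu h =>
  Nat.Partition.ext (by rw [← indexMultiset_partMonomial lam, h, indexMultiset_partMonomial])

lemma powerSumPart_eq {n : ℕ} (lam : n.Partition) :
    powerSumPart lam = powerSumEval (monomial (partMonomial lam) 1) := by
  rw [powerSumEval_monomial, indexMultiset_partMonomial, powerSumPart]

lemma powerSumNorm_eq {n : ℕ} (lam : n.Partition) :
    powerSumNorm lam = monomialNorm (partMonomial lam) := by
  classical
  have hc (i : ℕ) : lam.parts.count (i + 1) = partMonomial lam i := by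
    conv_lhs => rw [← indexMultiset_partMonomial lam, indexMultiset]
    rw [Multiset.count_map_eq_count' _ _ Nat.succ_injective, Finsupp.count_toMultiset]
  have hs : lam.parts.toFinset = (partMonomial lam).support.map ⟨Nat.succ, Nat.succ_injective⟩ := by
    ext j
    rw [Multiset.mem_toFinset, Finset.mem_map]
    constructor
    · intro hj
      refine ⟨j - 1, ?_, Nat.succ_pred_eq_of_pos (lam.parts_pos hj)⟩
      rw [Finsupp.mem_support_iff, ← hc, Nat.sub_add_cancel (lam.parts_pos hj)]
      exact Multiset.count_ne_zero.mpr hj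
    · rintro ⟨i, hi, rfl⟩
      rw [Finsupp.mem_support_iff, ← hc] at hi
      exact Multiset.count_ne_zero.mp hi
  rw [powerSumNorm, Finset.prod_multiset_map_count, ← Finset.prod_mul_distrib, hs,
    Finset.prod_map, monomialNorm, Finsupp.prod]
  refine Finset.prod_congr rfl fun i _ => ?_
  change (_ ^ lam.parts.count (i + 1) * _) * _ ^ lam.parts.count (i + 1) = _
  rw [varNorm, wt, div_div_eq_mul_div, mul_div_assoc, mul_pow]
  simp only [Function.Embedding.coeFn_mk, Nat.succ_eq_add_one, hc]
  ring

/-! ### Macdonald's scalar product -/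

/-- This supplies the existence needed for the choice in `macdonaldForm`. Any linear retraction
serves, as only values on products of power sums are prescribed. -/
lemma isMacdonaldForm_of_leftInverse {ψ : SymFun →ₗ[BaseField] PowerSumRing}
    (hψ : ∀ f, ψ (powerSumEval f) = f) : IsMacdonaldForm (polyForm.compl₁₂ ψ ψ) := by
  intro k l lam mu
  rw [LinearMap.compl₁₂_apply, powerSumPart_eq, powerSumPart_eq, hψ, hψ, polyForm_monomial,
    coeff_monomial, powerSumNorm_eq, one_mul]
  have h : partMonomial mu = partMonomial lam ↔ lam.parts = mu.parts := by
    rw [← indexMultiset_partMonomial lam, ← indexMultiset_partMonomial mu,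
      indexMultiset_injective.eq_iff, eq_comm]
  simp only [h, mul_ite, mul_one, mul_zero]

lemma macdonaldForm_spec : IsMacdonaldForm macdonaldForm := by
  obtain ⟨ψ, hψ⟩ := LinearMap.exists_leftInverse_of_injective powerSumEval.toLinearMap
    (LinearMap.ker_eq_bot.mpr powerSumEval_injective)
  exact Classical.epsilon_spec (p := IsMacdonaldForm)
    ⟨_, isMacdonaldForm_of_leftInverse fun f => LinearMap.congr_fun hψ f⟩

lemma exists_partMonomial_eq (d : ℕ →₀ ℕ) : ∃ (n : ℕ) (lam : n.Partition), partMonomial lam = d := by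
  let lam : (indexMultiset d).sum.Partition := ⟨indexMultiset d, fun {i} hi => by
    obtain ⟨j, -, rfl⟩ := Multiset.mem_map.mp hi
    exact j.succ_pos, rfl⟩
  exact ⟨_, lam, indexMultiset_injective (indexMultiset_partMonomial lam)⟩

/-- The defining property fixes the chosen form on the images of all monomials, hence on the whole
range of `powerSumEval`. -/
lemma macdonaldForm_powerSumEval (f g : PowerSumRing) :
    macdonaldForm (powerSumEval f) (powerSumEval g) = polyForm f g := by
  have h : macdonaldForm.compl₁₂ powerSumEval.toLinearMap powerSumEval.toLinearMap = polyForm := by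
    refine LinearMap.ext_basis (basisMonomials ℕ BaseField) (basisMonomials ℕ BaseField) ?_
    intro d e
    obtain ⟨k, lam, rfl⟩ := exists_partMonomial_eq d
    obtain ⟨l, mu, rfl⟩ := exists_partMonomial_eq e
    have hs := macdonaldForm_spec k l lam mu
    obtain ⟨ψ, hψ⟩ := LinearMap.exists_leftInverse_of_injective powerSumEval.toLinearMap
      (LinearMap.ker_eq_bot.mpr powerSumEval_injective)
    have hψ' : ∀ f, ψ (powerSumEval f) = f := fun f => LinearMap.congr_fun hψ f
    have hs' := isMacdonaldForm_of_leftInverse hψ' k l lam mu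
    rw [← hs, powerSumPart_eq, powerSumPart_eq, LinearMap.compl₁₂_apply, hψ', hψ'] at hs'
    simpa using hs'.symm
  exact LinearMap.congr_fun₂ h f g

/-- Dimension count: the `p_λ` are independent and the coefficients at partitions separate
homogeneous functions, so `E ∘ₗ T` is an injective endomorphism of a finite-dimensional space, hence
surjective. -/
lemma homogSym_le_range {n : ℕ} {f : SymFun} (hf : f ∈ homogSym n) :
    ∃ g, powerSumEval g = f := by
  classical
  let T : (n.Partition → BaseField) →ₗ[BaseField] SymFun :=
    Fintype.linearCombination BaseField powerSumPart
  let E : SymFun →ₗ[BaseField] (n.Partition → BaseField) :=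
    LinearMap.pi fun lam => coeffSym (partExp lam)
  have hT (c) : T c ∈ homogSym n :=
    Submodule.sum_mem _ fun lam _ => Submodule.smul_mem _ _ (powerSumPart_mem_homogSym lam)
  have hT' (c) : T c = powerSumEval (∑ lam, c lam • monomial (partMonomial lam) 1) := by
    rw [map_sum, Fintype.linearCombination_apply]
    simp only [map_smul, powerSumPart_eq]
  have hinj : Function.Injective (E ∘ₗ T) := by
    rw [injective_iff_map_eq_zero]
    intro c hc
    have h0 : T c = 0 := homogSym_ext (hT c) (Submodule.zero_mem _) fun lam => by
      rw [map_zero]; exact congrFun hc lam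
    rw [hT', map_eq_zero_iff _ powerSumEval_injective] at h0
    ext mu
    have h1 := congrArg (coeff (partMonomial mu)) h0
    simpa [coeff_sum, coeff_monomial, (partMonomial_injective n).eq_iff] using h1
  obtain ⟨c, hc⟩ := LinearMap.injective_iff_surjective.mp hinj (E f)
  refine ⟨_, (hT' c).symm.trans (homogSym_ext (hT c) hf fun lam => congrFun hc lam)⟩

lemma macdonaldForm_comm {n : ℕ} {f g : SymFun} (hf : f ∈ homogSym n) (hg : g ∈ homogSym n) :
    macdonaldForm f g = macdonaldForm g f := by
  obtain ⟨f, rfl⟩ := homogSym_le_range hf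
  obtain ⟨g, rfl⟩ := homogSym_le_range hg
  rw [macdonaldForm_powerSumEval, macdonaldForm_powerSumEval, polyForm_comm]

lemma eq_zero_of_macdonaldForm_self {n : ℕ} {f : SymFun} (hf : f ∈ homogSym n)
    (h : macdonaldForm f f = 0) : f = 0 := by
  obtain ⟨f, rfl⟩ := homogSym_le_range hf
  by_contra hne
  rw [macdonaldForm_powerSumEval] at h
  exact polyForm_self_ne_zero (fun h0 => hne (by rw [h0, map_zero])) h

/-- The `g_λ` and the `m_λ` are dual to each other. -/
theorem macdonaldForm_gSymPart {n : ℕ} (lam : n.Partition) {f : SymFun} (hf : f ∈ homogSym n) :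
    macdonaldForm (gSymPart lam) f = coeffSym (partExp lam) f := by
  obtain ⟨f, rfl⟩ := homogSym_le_range hf
  have h : gSymPart lam = powerSumEval (gPolyProd (partExp lam)) := by
    rw [gPolyProd_eq_multiset_prod, exponents_partExp, map_multiset_prod, Multiset.map_map,
      gSymPart]
    exact congrArg _ (Multiset.map_congr rfl fun m _ => (powerSumEval_gPoly m).symm)
  rw [h, macdonaldForm_powerSumEval, polyForm_gPolyProd]

end PowerSumRing

/-! ### The Macdonald symmetric functions -/

/-- At the first difference the partial sums force the smaller entry to lie in `a`. Positivity rules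
out that `b` is a proper prefix of `a`. -/
lemma lexLT_of_take_sum_le {a b : List ℕ} (ha : ∀ x ∈ a, 0 < x) (hne : a ≠ b)
    (h : ∀ i, (a.take i).sum ≤ (b.take i).sum) : a < b := by
  induction a generalizing b with
  | nil =>
    cases b with
    | nil => exact absurd rfl hne
    | cons y b => exact List.nil_lt_cons y b
  | cons x a ih =>
    cases b with
    | nil =>
      have h1 := h 1
      have h2 := ha x List.mem_cons_self
      simp at h1
      omega
    | cons y b =>
      have h1 : x ≤ y := by simpa using h 1
      rw [List.cons_lt_cons_iff]
      rcases h1.lt_or_eq with h1 | rfl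
      · exact Or.inl h1
      · refine Or.inr ⟨rfl, ih (fun z hz => ha z (List.mem_cons_of_mem _ hz))
          (fun hab => hne (by rw [hab])) fun i => ?_⟩
        simpa using h (i + 1)

lemma sortedParts_injective (n : ℕ) : Function.Injective (sortedParts (n := n)) := fun lam mu h =>
  Nat.Partition.ext <| by
    rw [← Multiset.sort_eq lam.parts (· ≥ ·), ← Multiset.sort_eq mu.parts (· ≥ ·)]
    exact congrArg _ h

lemma lexLT_of_dominanceLE {n : ℕ} {mu lam : n.Partition} (h : DominanceLE mu lam)
    (hne : mu ≠ lam) : LexLT mu lam :=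
  lexLT_of_take_sum_le (fun x hx => mu.parts_pos (by simpa [sortedParts] using hx))
    (fun h' => hne (sortedParts_injective n h')) h

lemma lexLT_trichotomy {n : ℕ} (mu lam : n.Partition) : LexLT mu lam ∨ mu = lam ∨ LexLT lam mu := by
  rcases lt_trichotomy (sortedParts mu) (sortedParts lam) with h | h | h
  · exact Or.inl h
  · exact Or.inr (Or.inl (sortedParts_injective n h))
  · exact Or.inr (Or.inr h)

/-- The span of the monomial symmetric functions that precede `m_λ` lexicographically. -/
def lexSpan {n : ℕ} (lam : n.Partition) : Submodule BaseField SymFun :=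
  Submodule.span BaseField (monomialSym '' {mu | LexLT mu lam})

lemma lexSpan_le_homogSym {n : ℕ} (lam : n.Partition) : lexSpan lam ≤ homogSym n := by
  rw [lexSpan, Submodule.span_le]
  rintro _ ⟨mu, -, rfl⟩
  exact monomialSym_mem_homogSym mu

lemma lexSpan_mono {n : ℕ} {mu lam : n.Partition} (h : LexLT mu lam) :
    lexSpan mu ≤ lexSpan lam :=
  Submodule.span_mono (Set.image_mono fun _ hnu => lt_trans (α := List ℕ) hnu h)

/-- A unitriangular family: `P_λ` is `m_λ` plus lexicographically smaller terms. -/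
def IsUnitriangular {n : ℕ} (P : n.Partition → SymFun) : Prop :=
  ∀ lam, P lam - monomialSym lam ∈ lexSpan lam

namespace IsUnitriangular

variable {n : ℕ} {P : n.Partition → SymFun}

lemma mem_homogSym (hP : IsUnitriangular P) (lam : n.Partition) : P lam ∈ homogSym n := by
  simpa using Submodule.add_mem _ (lexSpan_le_homogSym lam (hP lam)) (monomialSym_mem_homogSym lam)

lemma ne_zero (hP : IsUnitriangular P) (lam : n.Partition) : P lam ≠ 0 := by
  classical
  intro h0
  have h := hP lam
  rw [h0, zero_sub, Submodule.neg_mem_iff] at h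
  have hz : ∀ f ∈ lexSpan lam, coeffSym (partExp lam) f = 0 := by
    intro f hf
    refine (Submodule.span_le (p := LinearMap.ker (coeffSym (partExp lam)))).mpr ?_ hf
    rintro _ ⟨mu, hmu, rfl⟩
    rw [SetLike.mem_coe, LinearMap.mem_ker, coeffSym_partExp_monomialSym, if_neg]
    rintro rfl
    exact lt_irrefl (α := List ℕ) _ hmu
  simpa [coeffSym_partExp_monomialSym] using hz _ h

/-- A unitriangular change of basis is inverted by recursion along the order. -/
lemma lexSpan_le (hP : IsUnitriangular P) (lam : n.Partition) :
    lexSpan lam ≤ Submodule.span BaseField (P '' {mu | LexLT mu lam}) := by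
  induction lam using (lexLT_wellFounded n).induction with
  | _ lam ih =>
    rw [lexSpan, Submodule.span_le]
    rintro _ ⟨mu, hmu, rfl⟩
    have h1 := (ih mu hmu).trans (Submodule.span_mono (Set.image_mono
      (fun nu hnu => lt_trans (α := List ℕ) hnu hmu : {nu | LexLT nu mu} ⊆ {nu | LexLT nu lam})))
      (hP mu)
    have h2 : P mu ∈ Submodule.span BaseField (P '' {mu | LexLT mu lam}) :=
      Submodule.subset_span ⟨mu, hmu, rfl⟩
    simpa using Submodule.sub_mem _ h2 h1

lemma homogSym_le_span (hP : IsUnitriangular P) :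
    homogSym n ≤ Submodule.span BaseField (Set.range P) := by
  intro f hf
  rw [eq_sum_monomialSym hf]
  refine Submodule.sum_mem _ fun lam _ => Submodule.smul_mem _ _ ?_
  have h1 := ((hP.lexSpan_le lam).trans (Submodule.span_mono (Set.image_subset_range _ _))) (hP lam)
  have h2 : P lam ∈ Submodule.span BaseField (Set.range P) := Submodule.subset_span ⟨lam, rfl⟩
  simpa using Submodule.sub_mem _ h2 h1

lemma form_self_ne_zero (hP : IsUnitriangular P) (lam : n.Partition) :
    macdonaldForm (P lam) (P lam) ≠ 0 := fun h =>
  hP.ne_zero lam (eq_zero_of_macdonaldForm_self (hP.mem_homogSym lam) h)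

end IsUnitriangular

/-- A vector of a subspace spanned by a set to which it is orthogonal vanishes. -/
lemma eq_zero_of_mem_span {n : ℕ} {S : Set SymFun} {f : SymFun} (hf : f ∈ homogSym n)
    (hS : f ∈ Submodule.span BaseField S) (h : ∀ g ∈ S, macdonaldForm f g = 0) : f = 0 := by
  refine eq_zero_of_macdonaldForm_self hf ?_
  exact (Submodule.span_le (p := LinearMap.ker (macdonaldForm f))).mpr h hS

lemma isUnitriangular_macdonaldP (n : ℕ) : IsUnitriangular (macdonaldP (n := n)) := by
  intro lam
  induction lam using (lexLT_wellFounded n).induction with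
  | _ lam ih =>
    rw [macdonaldP_eq, sub_sub_cancel_left, Submodule.neg_mem_iff]
    refine Submodule.sum_mem _ fun mu _ => Submodule.smul_mem _ _ ?_
    have h := lexSpan_mono mu.2 (ih mu.1 mu.2)
    have h2 : monomialSym mu.1 ∈ lexSpan lam := Submodule.subset_span ⟨mu.1, mu.2, rfl⟩
    simpa using Submodule.add_mem _ h h2

lemma macdonaldP_mem_homogSym {n : ℕ} (lam : n.Partition) : macdonaldP lam ∈ homogSym n :=
  (isUnitriangular_macdonaldP n).mem_homogSym lam

lemma macdonaldForm_macdonaldP_of_lexLT {n : ℕ} (lam : n.Partition) :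
    ∀ mu, LexLT mu lam → macdonaldForm (macdonaldP lam) (macdonaldP mu) = 0 := by
  classical
  induction lam using (lexLT_wellFounded n).induction with
  | _ lam ih =>
    intro mu hmu
    -- The earlier vectors are mutually orthogonal, so only the `mu` term of the Gram–Schmidt sum
    -- survives the pairing, and it cancels.
    have hnu (nu : {nu : n.Partition // LexLT nu lam}) (hne : nu ≠ ⟨mu, hmu⟩) :
        macdonaldForm (macdonaldP nu.1) (macdonaldP mu) = 0 := by
      rcases lexLT_trichotomy nu.1 mu with h | h | h
      · rw [macdonaldForm_comm (macdonaldP_mem_homogSym _) (macdonaldP_mem_homogSym _)]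
        exact ih mu hmu _ h
      · exact absurd (Subtype.ext h) hne
      · exact ih nu.1 nu.2 mu h
    rw [macdonaldP_eq lam, map_sub, LinearMap.sub_apply, map_sum, LinearMap.sum_apply,
      Finset.sum_eq_single ⟨mu, hmu⟩]
    · rw [map_smul, LinearMap.smul_apply, smul_eq_mul,
        div_mul_cancel₀ _ ((isUnitriangular_macdonaldP n).form_self_ne_zero mu), sub_self]
    · intro nu _ hne
      rw [map_smul, LinearMap.smul_apply, hnu nu hne, smul_zero]
    · exact fun h => absurd (Finset.mem_univ _) h

lemma macdonaldForm_macdonaldP {n : ℕ} {lam mu : n.Partition} (h : lam ≠ mu) :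
    macdonaldForm (macdonaldP lam) (macdonaldP mu) = 0 := by
  rcases lexLT_trichotomy lam mu with h' | h' | h'
  · rw [macdonaldForm_comm (macdonaldP_mem_homogSym _) (macdonaldP_mem_homogSym _)]
    exact macdonaldForm_macdonaldP_of_lexLT mu lam h'
  · exact absurd h' h
  · exact macdonaldForm_macdonaldP_of_lexLT lam mu h'

/-- The difference of the two candidates at `lam` lies in the span of the earlier `macdonaldP mu`.
By induction these equal `P mu`, so the difference is orthogonal to all of them and hence to itself.
-/
theorem IsMacdonaldFamily.eq_macdonaldP {n : ℕ} {P : n.Partition → SymFun}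
    (hP : IsMacdonaldFamily n P) : P = macdonaldP := by
  classical
  have hU : IsUnitriangular P := by
    intro lam
    obtain ⟨a, ha⟩ := hP.1 lam
    rw [ha, add_sub_cancel_left]
    refine Submodule.sum_mem _ fun mu hmu => Submodule.smul_mem _ _ (Submodule.subset_span ?_)
    obtain ⟨-, h1, h2⟩ := Finset.mem_filter.mp hmu
    exact ⟨mu, lexLT_of_dominanceLE h1 h2, rfl⟩
  funext lam
  induction lam using (lexLT_wellFounded n).induction with
  | _ lam ih =>
    have hM := isUnitriangular_macdonaldP n
    have hd : P lam - macdonaldP lam ∈ lexSpan lam := by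
      simpa using Submodule.sub_mem _ (hU lam) (hM lam)
    refine sub_eq_zero.mp (eq_zero_of_mem_span (lexSpan_le_homogSym lam hd)
      (hM.lexSpan_le lam hd) ?_)
    rintro _ ⟨mu, hmu, rfl⟩
    have hne : lam ≠ mu := fun h => lt_irrefl (α := List ℕ) _ (h ▸ hmu : LexLT lam lam)
    rw [map_sub, LinearMap.sub_apply, macdonaldForm_macdonaldP hne, ← ih mu hmu, hP.2 _ _ hne,
      sub_zero]

/-! ### The kernel function -/

lemma macdonaldForm_gSymPart_monomialSym {n : ℕ} [DecidableEq n.Partition]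
    (lam mu : n.Partition) :
    macdonaldForm (gSymPart lam) (monomialSym mu) = if lam = mu then 1 else 0 := by
  rw [macdonaldForm_gSymPart lam (monomialSym_mem_homogSym mu), coeffSym_partExp_monomialSym]

/-- The expansion of a homogeneous symmetric function in the `g_μ`. -/
lemma eq_sum_gSymPart {n : ℕ} {f : SymFun} (hf : f ∈ homogSym n) :
    f = ∑ mu : n.Partition, macdonaldForm f (monomialSym mu) • gSymPart mu := by
  classical
  have hs : ∑ mu : n.Partition, macdonaldForm f (monomialSym mu) • gSymPart mu ∈ homogSym n :=
    Submodule.sum_mem _ fun mu _ => Submodule.smul_mem _ _ (gSymPart_mem_homogSym mu)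
  have hd := Submodule.sub_mem _ hf hs
  refine sub_eq_zero.mp (eq_zero_of_mem_span (S := Set.range (monomialSym (n := n))) hd ?_ ?_)
  · rw [eq_sum_monomialSym hd]
    exact Submodule.sum_mem _ fun mu _ => Submodule.smul_mem _ _ (Submodule.subset_span ⟨mu, rfl⟩)
  · rintro _ ⟨mu, rfl⟩
    simp [macdonaldForm_gSymPart_monomialSym]

/-- Pairing an expansion in the `g_μ` with the dual basis reads off its coefficients, whatever
choice was made. -/
lemma coeffGtoP_eq {n : ℕ} (lam mu : n.Partition) :
    coeffGtoP lam mu = macdonaldForm (macdonaldP lam) (monomialSym mu) := by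
  classical
  have h : macdonaldP lam = ∑ mu, coeffGtoP lam mu • gSymPart mu :=
    Classical.epsilon_spec (p := fun c : n.Partition → BaseField =>
      macdonaldP lam = ∑ mu, c mu • gSymPart mu)
      ⟨_, eq_sum_gSymPart (macdonaldP_mem_homogSym lam)⟩
  rw [h]
  simp [macdonaldForm_gSymPart_monomialSym]

/-- By `coeffGtoP_eq` this is the orthogonal expansion of `m_μ`, with `Q_λ` dual to `P_λ`: the
difference of the two sides pairs to zero with every `P_ν`. -/
lemma sum_coeffGtoP_smul_macdonaldQ {n : ℕ} (mu : n.Partition) :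
    ∑ lam, coeffGtoP lam mu • macdonaldQ lam = monomialSym mu := by
  have hM := isUnitriangular_macdonaldP n
  have hs : ∑ lam, coeffGtoP lam mu • macdonaldQ lam ∈ homogSym n :=
    Submodule.sum_mem _ fun lam _ => Submodule.smul_mem _ _
      (Submodule.smul_mem _ _ (macdonaldP_mem_homogSym lam))
  have hd := Submodule.sub_mem _ hs (monomialSym_mem_homogSym mu)
  refine sub_eq_zero.mp (eq_zero_of_mem_span hd (hM.homogSym_le_span hd) ?_)
  rintro _ ⟨nu, rfl⟩
  rw [map_sub, LinearMap.sub_apply, map_sum, LinearMap.sum_apply, Finset.sum_eq_single nu]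
  · rw [map_smul, LinearMap.smul_apply, macdonaldQ, map_smul, LinearMap.smul_apply, smul_eq_mul,
      smul_eq_mul, inv_mul_cancel₀ (hM.form_self_ne_zero nu), mul_one, coeffGtoP_eq,
      macdonaldForm_comm (macdonaldP_mem_homogSym nu) (monomialSym_mem_homogSym mu), sub_self]
  · intro lam _ hne
    rw [map_smul, LinearMap.smul_apply, macdonaldQ, map_smul, LinearMap.smul_apply,
      macdonaldForm_macdonaldP hne, smul_zero, smul_zero]
  · exact fun h => absurd (Finset.mem_univ _) h

theorem kernelK_eq (n : ℕ) :
    kernelK n = ((-1) ^ n / ((1 - q) ^ n * (n.factorial : BaseField))) •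
      ∑ lam : n.Partition, monomialSym lam ⊗ₜ[BaseField] (multinom lam • epsilonPart lam t) := by
  simp only [kernelK, macdonaldF, TensorProduct.tmul_smul, TensorProduct.tmul_sum]
  rw [← Finset.smul_sum, Finset.sum_comm]
  congr 1
  refine Finset.sum_congr rfl fun mu _ => ?_
  rw [← sum_coeffGtoP_smul_macdonaldQ mu, TensorProduct.sum_tmul, Finset.smul_sum]
  refine Finset.sum_congr rfl fun lam _ => ?_
  rw [← TensorProduct.smul_tmul', smul_smul, mul_comm]

end MacdonaldKernel

end

theorem mainTheorem3 (n : ℕ) :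
    (∀ P : n.Partition → MacdonaldKernel.SymFun,
      MacdonaldKernel.IsMacdonaldFamily n P → P = MacdonaldKernel.macdonaldP) ∧
    MacdonaldKernel.kernelK n =
      ((-1) ^ n / ((1 - MacdonaldKernel.q) ^ n * (n.factorial : MacdonaldKernel.BaseField))) •
        ∑ lam : n.Partition,
          MacdonaldKernel.monomialSym lam ⊗ₜ[MacdonaldKernel.BaseField]
            (MacdonaldKernel.multinom lam •
              MacdonaldKernel.epsilonPart lam MacdonaldKernel.t) :=
  ⟨fun _ hP => hP.eq_macdonaldP, MacdonaldKernel.kernelK_eq n⟩
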